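/- Let $d\ge 2$, let $X\subseteq\mathbb R^d$ be closed and convex, let $\zeta$ be a random element of a measurable space $\Xi$ with law $\mathbb P$, and let $F:\mathbb R^d\times\Xi\to\mathbb R$ be such that $f(x)=\mathbb E[F(x,\zeta)]$ is well defined and finite for every $x\in\mathbb R^d$, $f$ is everywhere differentiable, $F(\cdot,z)$ is everywhere differentiable for every $z\in\Xi$, and $\nabla F$ (the gradient in $x$) is measurable on $X\times\Xi$. Assume that for some $\sigma_\infty$, some $L\ge 0$ and some $\underline f\in\mathbb R$, for all $x,y\in X$: (i) $\mathbb E[\nabla F(x,\zeta)]=\nabla f(x)$; (ii) $\mathbb E[\|\nabla F(x,\zeta)-\nabla f(x)\|_\infty^2]\le\sigma_\infty^2$; (iii) $\mathbb E[\|\nabla F(x,\zeta)-\nabla F(y,\zeta)\|_\infty^2]\le L^2\|x-y\|_1^2$ (mean-squared smoothness); (iv) $f(x)\ge\underline f$. Let $\psi,\eta>0$, let $K,q,m,m_1$ be positive integers, and consider the following algorithm. Start from a (possibly random) point $x^1\in X$ with $\mathbb E|f(x^1)|<\infty$. For $k=1,\dots,K$ put $n_k=\lfloor (k-1)/q\rfloor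 q+1$, let $m_k=m_1$ if $k=n_k$ and $m_k=m$ otherwise, draw $\zeta^k_1,\dots,\zeta^k_{m_k}$, and set $$G^k=\begin{cases}\dfrac1{m_k}\displaystyle\sum_{i=1}^{m_k}\nabla F(x^k,\zeta^k_i), & k=n_k,\\[2ex] \dfrac1{m_k}\displaystyle\sum_{i=1}^{m_k}\bigl(\nabla F(x^k,\zeta^k_i)-\nabla F(x^{k-1},\zeta^k_i)\bigr)+G^{k-1}, & k\ne n_k,\end{cases}$$ $$x^{k+1}=\operatorname*{arg\,min}_{x\in X}\Bigl\{\tfrac12\|x-(x^k-\eta G^k)\|_2^2+\phi(x-x^k)\Bigr\},$$ where $\phi(z)=0$ if $\|z\|_1\le\psi$ and $\phi(z)=+\infty$ otherwise. The samples $\zeta^k_i$ all have law $\mathbb P$, $Y$ is uniformly distributed on $\{1,\dots,K\}$, and $x^1$, $Y$ and all the $\zeta^k_i$ are mutually independent. The output is $x^{Y+1}$. Let $\Delta_f=\mathbb E[f(x^1)]-\underline f$, $\Omega=e^2\log d$, $c=e^2$, and let $\delta_X$ be the indicator function of $X$ ($0$ on $X$, $+\infty$ elsewhere). For $x\in X$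 write $\operatorname{dist}_{\|\cdot\|_\infty}(0,\partial(f+\delta_X)(x))=\inf\{\|v\|_\infty: v\in\partial(f+\delta_X)(x)\}$, where $\partial$ denotes the subdifferential, that is, $v\in\partial h(x)$ if and only if $h(x)$ is finite and $h(y)\ge h(x)+\langle v,y-x\rangle-o(\|y-x\|)$ as $y\to x$. Then for every $t>0$, $$\begin{aligned}\mathbb E\bigl[\operatorname{dist}_{\|\cdot\|_\infty}(0,\partial(f+\delta_X)(x^{Y+1}))\bigr]\le{}&\Bigl(L+\frac1\eta+\sqrt{\frac{4\Omega^2L^2q}{m}}\Bigr)\psi+\sqrt{\frac{\Omega\,c(\log d)\,\sigma_\infty^2}{m_1}}\\&+\frac1\psi\Bigl(\frac{\Delta_f}{K}+\frac{t\,\Omega\,c(\log d)\,\sigma_\infty^2}{2m_1}+\Bigl(\frac{2t\,\Omega^2L^2q}{m}+\frac L2+\frac1{2t}\Bigr)\psi^2\Bigr).\end{aligned}$$ -/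

import Mathlib

open MeasureTheory ProbabilityTheory Filter Topology
open scoped ENNReal

noncomputable section

namespace SpiderProx

/-- The decision space `ℝ^d`, with its Euclidean norm and inner product. -/
abbrev Vec (d : ℕ) : Type := EuclideanSpace ℝ (Fin d)

/-- The `ℓ₁`-norm on `ℝ^d`. -/
def l1Norm {d : ℕ} (x : Vec d) : ℝ := ∑ i, |x i|

/-- The `ℓ_∞`-norm on `ℝ^d` (the norm of the function space `Fin d → ℝ` is the sup norm). -/
def linfNorm {d : ℕ} (x : Vec d) : ℝ := ‖(WithLp.ofLp x : Fin d → ℝ)‖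

open Classical in
/-- The convex indicator function `δ_S`: `0` on `S` and `+∞` off `S`. -/
def indicatorFn {d : ℕ} (S : Set (Vec d)) (x : Vec d) : EReal := if x ∈ S then 0 else ⊤

/-- The closed `ℓ₁`-ball of radius `ψ` around the origin. -/
def l1Ball (d : ℕ) (ψ : ℝ) : Set (Vec d) := {z | l1Norm z ≤ ψ}

/-! ### Stationarity residual -/

/-- The (regular, or Fréchet) subdifferential of an extended-real-valued function `h` at `x`:
`h x` is finite and `h y ≥ h x + ⟨v, y - x⟩ - o(‖y - x‖)` as `y → x`. For `h = f + δ_X` with `X`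
closed convex and `f` differentiable with gradient continuous along `X`, it is
`∇f(x) + N_X(x)` and coincides with the limiting subdifferential. -/
def subdifferential {d : ℕ} (h : Vec d → EReal) (x : Vec d) : Set (Vec d) :=
  {v | h x ≠ ⊤ ∧ h x ≠ ⊥ ∧ ∀ ε : ℝ, 0 < ε → ∀ᶠ y in 𝓝 x,
    h x + ((inner ℝ v (y - x) - ε * ‖y - x‖ : ℝ) : EReal) ≤ h y}

/-- The residual `r(x) = dist_{‖·‖_∞}(0, ∂(f + δ_X)(x)) = inf {‖v‖_∞ : v ∈ ∂(f + δ_X)(x)}`, with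
`inf ∅ = +∞`. -/
def residual {d : ℕ} (f : Vec d → ℝ) (X : Set (Vec d)) (x : Vec d) : ℝ≥0∞ :=
  ⨅ v ∈ subdifferential (fun y => (f y : EReal) + indicatorFn X y) x, ENNReal.ofReal (linfNorm v)

/-! ### The stochastic problem and its assumptions -/

section Problem

variable {d : ℕ} {Ξ : Type*} [MeasurableSpace Ξ]

/-- The objective `f(x) = 𝔼[F(x, ζ)]`. -/
def objective (F : Vec d → Ξ → ℝ) (P : Measure Ξ) (x : Vec d) : ℝ := ∫ z, F x z ∂P

/-- The stochastic gradient `∇F(x, z)`, the gradient being taken in `x`. -/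
def stochGrad (F : Vec d → Ξ → ℝ) (x : Vec d) (z : Ξ) : Vec d := gradient (fun y => F y z) x

/-- Standing assumptions on the problem `min_{x ∈ X} f(x)`, `f(x) = 𝔼[F(x, ζ)]`, for the
stochastic first-order oracle `G = ∇F`. -/
structure IsProblem (X : Set (Vec d)) (F : Vec d → Ξ → ℝ) (P : Measure Ξ) : Prop where
  isClosed : IsClosed X
  convex : Convex ℝ X
  integrable : ∀ x, Integrable (F x) P
  differentiable_objective : Differentiable ℝ (objective F P)
  differentiable : ∀ z, Differentiable ℝ (fun x => F x z)
  measurable_oracle : Measurable (fun p : X × Ξ => stochGrad F (p.1 : Vec d) p.2)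
  integrable_oracle : ∀ x ∈ X, Integrable (stochGrad F x) P
  unbiased : ∀ x ∈ X, ∫ z, stochGrad F x z ∂P = gradient (objective F P) x

/-- `𝔼[‖∇F(x, ζ) - ∇f(x)‖_∞²] ≤ σ²` for all `x ∈ X`. -/
def BoundedVariance (X : Set (Vec d)) (F : Vec d → Ξ → ℝ) (P : Measure Ξ) (σ : ℝ) : Prop :=
  ∀ x ∈ X,
    Integrable (fun z => linfNorm (stochGrad F x z - gradient (objective F P) x) ^ 2) P ∧
    ∫ z, linfNorm (stochGrad F x z - gradient (objective F P) x) ^ 2 ∂P ≤ σ ^ 2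

/-- `𝔼[‖∇F(x, ζ) - ∇F(y, ζ)‖_∞²] ≤ L² ‖x - y‖₁²` for all `x, y ∈ X`. -/
def MeanSquaredSmooth (X : Set (Vec d)) (F : Vec d → Ξ → ℝ) (P : Measure Ξ) (L : ℝ) : Prop :=
  ∀ x ∈ X, ∀ y ∈ X,
    Integrable (fun z => linfNorm (stochGrad F x z - stochGrad F y z) ^ 2) P ∧
    ∫ z, linfNorm (stochGrad F x z - stochGrad F y z) ^ 2 ∂P ≤ L ^ 2 * l1Norm (x - y) ^ 2

end Problem

/-! ### The algorithm -/

/-- `n_k = ⌊(k - 1) / q⌋ q + 1`, the first iteration of the epoch of length `q` containing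
iteration `k ≥ 1`. -/
def epochStart (q k : ℕ) : ℕ := (k - 1) / q * q + 1

/-- The batch size `m_k`: `m₁` at the first iteration of an epoch and `m` otherwise. -/
def batchSize (q m m₁ k : ℕ) : ℕ := if k = epochStart q k then m₁ else m

/-- `p = P_X^k(v)`: the point `p` of `X` minimizes `½‖y - v‖² + φ(y - xk)` over `y ∈ X`. -/
def IsProxPoint {d : ℕ} (X : Set (Vec d)) (φ : Vec d → EReal) (xk v p : Vec d) : Prop :=
  p ∈ X ∧ IsMinOn (fun y => (((1 / 2) * ‖y - v‖ ^ 2 : ℝ) : EReal) + φ (y - xk)) X p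

/-- A run of `K` iterations of the stochastic first-order method with proximal term `φ`, step size
`η` and SPIDER gradient estimates, on a probability space `(Ω, μ)`: iterates `x k`, gradient
estimates `G k`, samples `ζ k i` and the random output index `Y` (so the output is `x (Y + 1)`). -/
structure IsSpiderRun {d : ℕ} {Ξ Ω : Type*} [MeasurableSpace Ξ] [MeasurableSpace Ω]
    (X : Set (Vec d)) (F : Vec d → Ξ → ℝ) (P : Measure Ξ) (φ : Vec d → EReal) (η : ℝ)
    (K q m m₁ : ℕ) (μ : Measure Ω)
    (x G : ℕ → Ω → Vec d) (ζ : ℕ → ℕ → Ω → Ξ) (Y : Ω → ℕ) : Prop where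
  measurable_init : Measurable (x 1)
  init_mem : ∀ ω, x 1 ω ∈ X
  measurable_sample : ∀ k i, Measurable (ζ k i)
  law_sample : ∀ k i, μ.map (ζ k i) = P
  indep_sample : iIndepFun (fun p : ℕ × ℕ => ζ p.1 p.2) μ
  indep_init : IndepFun (x 1) (fun ω (p : ℕ × ℕ) => ζ p.1 p.2 ω) μ
  measurable_output : Measurable Y
  output_uniform : ∀ k, 1 ≤ k → k ≤ K → μ {ω | Y ω = k} = (K : ℝ≥0∞)⁻¹
  indep_output : IndepFun Y (fun ω => (x 1 ω, fun p : ℕ × ℕ => ζ p.1 p.2 ω)) μ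
  estimate_start : ∀ k, 1 ≤ k → k ≤ K → k = epochStart q k → ∀ ω,
    G k ω = (1 / (batchSize q m m₁ k : ℝ)) •
      ∑ i ∈ Finset.range (batchSize q m m₁ k), stochGrad F (x k ω) (ζ k i ω)
  estimate_inner : ∀ k, 1 ≤ k → k ≤ K → k ≠ epochStart q k → ∀ ω,
    G k ω = (1 / (batchSize q m m₁ k : ℝ)) •
      (∑ i ∈ Finset.range (batchSize q m m₁ k), stochGrad F (x k ω) (ζ k i ω) -
        ∑ i ∈ Finset.range (batchSize q m m₁ k), stochGrad F (x (k - 1) ω) (ζ k i ω)) +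
      G (k - 1) ω
  step : ∀ k, 1 ≤ k → k ≤ K → ∀ ω,
    IsProxPoint X φ (x k ω) (x k ω - η • G k ω) (x (k + 1) ω)

/-! ### Constants of the bound -/

/-- The absolute constant `c = e²`. -/
def constC : ℝ := Real.exp 1 ^ 2

/-- `Ω = e² log d`. -/
def constOmega (d : ℕ) : ℝ := Real.exp 1 ^ 2 * Real.log d

end SpiderProx

end

noncomputable section

namespace SpiderProx

/-! The residual at a new iterate is traded for descent by ℓ₁/ℓ_∞ duality. The proximal point p is
the Euclidean projection of a - ηg onto X intersected with the ℓ₁-ball of radius ψ about a. With w =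
(p - a)/η + g, separation yields n normal to X at p such that s = w + n satisfies ψ‖s‖_∞ ≤ -⟨s, p -
a⟩. As ∇f(p) + n is a subgradient of f + δ_X, the residual is at most ‖g - ∇f(a)‖_∞ + (L + 1/η)ψ +
‖s‖_∞. The inner product is controlled by f(a) - f(p), an error term from Young's inequality with
parameter t, and multiples of ψ², because ∇f is L-Lipschitz from ℓ₁ to ℓ_∞. This is
`IsBallProj.key_inequality`; averaging over the independent uniform index makes the function values
telescope.

What remains is the second moment of G^k - ∇f(x^k). The square of the ℓ_∞ norm is not smooth, but it
is comparable to the squared ℓ_p norm, p = 2n + 2, whose Taylor remainder is at most 2n + 1 times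
the squared norm of the increment (`exists_powerNormSq_add_le`). The linear term vanishes in
expectation against a centered increment, so second moments of martingale increments add up with the
constant (2n + 1)d^(1/(n+1)), which a suitable n brings below Ω² (`exists_smoothConst_le`). Within
an epoch the error is such a martingale: the restart contributes σ²/m₁ and each of the fewer than q
later iterations at most 4L²ψ²/m, consecutive iterates being within ψ in ℓ₁ norm
(`IsSpiderRun.lintegral_lpNormSq_error_le`). -/

/-- If `φ'` grows at most linearly with slope `2 M` on `[0, 1]`, then `φ` lies below its
second-order Taylor majorant at `1`. -/
theorem le_taylor_of_deriv_le {φ φ' : ℝ → ℝ} {M : ℝ}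
    (hφ : ∀ s ∈ Set.Icc (0 : ℝ) 1, HasDerivAt φ (φ' s) s)
    (hM : ∀ s ∈ Set.Icc (0 : ℝ) 1, φ' s ≤ φ' 0 + 2 * M * s) :
    φ 1 ≤ φ 0 + φ' 0 + M := by
  have hd : ∀ s ∈ Set.Icc (0 : ℝ) 1,
      HasDerivAt (fun s => φ s - φ' 0 * s - M * s ^ 2) (φ' s - φ' 0 - 2 * M * s) s := by
    intro s hs
    have h1 := ((hφ s hs).sub ((hasDerivAt_id s).const_mul (φ' 0))).sub
      (((hasDerivAt_id s).pow 2).const_mul M)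
    refine h1.congr_deriv ?_
    simp; ring
  have hanti : AntitoneOn (fun s => φ s - φ' 0 * s - M * s ^ 2) (Set.Icc 0 1) := by
    refine antitoneOn_of_deriv_nonpos (convex_Icc 0 1)
      (fun s hs => (hd s hs).continuousAt.continuousWithinAt)
      (fun s hs => (hd s (interior_subset hs)).differentiableAt.differentiableWithinAt) ?_
    intro s hs
    rw [(hd s (interior_subset hs)).deriv]
    linarith [hM s (interior_subset hs)]
  have := hanti (Set.left_mem_Icc.2 zero_le_one) (Set.right_mem_Icc.2 zero_le_one) zero_le_one
  simp at this
  linarith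

/-! ### Smoothness of squared ℓ_p norms, p even -/

section PowerNorm

variable {ι : Type*} [Fintype ι]

/-- The regularized power function `(ε + ∑ x_i ^ (2 n + 2)) ^ (1 / (n + 1))`. At `ε = 0` it is the
square of the `ℓ_p` norm with `p = 2 n + 2`. -/
def powerNormSq (n : ℕ) (ε : ℝ) (x : ι → ℝ) : ℝ :=
  (ε + ∑ i, x i ^ (2 * n + 2)) ^ (1 / ((n : ℝ) + 1))

theorem sum_even_pow_nonneg (n : ℕ) (x : ι → ℝ) : 0 ≤ ∑ i, x i ^ (2 * n + 2) :=
  Finset.sum_nonneg fun i _ => Even.pow_nonneg ⟨n + 1, by ring⟩ _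

theorem powerNormSq_nonneg (n : ℕ) {ε : ℝ} (hε : 0 ≤ ε) (x : ι → ℝ) : 0 ≤ powerNormSq n ε x :=
  Real.rpow_nonneg (add_nonneg hε (sum_even_pow_nonneg n x)) _

theorem powerNormSq_mono (n : ℕ) {ε : ℝ} (hε : 0 ≤ ε) (x : ι → ℝ) :
    powerNormSq n 0 x ≤ powerNormSq n ε x := by
  have := sum_even_pow_nonneg n x
  unfold powerNormSq
  gcongr

theorem continuous_powerNormSq (n : ℕ) (ε : ℝ) :
    Continuous (powerNormSq n ε : (ι → ℝ) → ℝ) := by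
  unfold powerNormSq
  refine Continuous.rpow_const (by fun_prop) fun x => Or.inr (by positivity)

theorem tendsto_powerNormSq (n : ℕ) (x : ι → ℝ) :
    Tendsto (fun ε => powerNormSq n ε x) (𝓝[>] 0) (𝓝 (powerNormSq n 0 x)) := by
  have : Continuous fun ε => powerNormSq n ε x := by
    unfold powerNormSq
    refine Continuous.rpow_const (by fun_prop) fun x => Or.inr (by positivity)
  exact (this.tendsto 0).mono_left nhdsWithin_le_nhds

theorem sq_norm_le_powerNormSq (n : ℕ) (x : ι → ℝ) : ‖x‖ ^ 2 ≤ powerNormSq n 0 x := by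
  have hn : (0 : ℝ) < (n : ℝ) + 1 := by positivity
  have key : ‖x‖ ^ (2 * n + 2) ≤ ∑ i, x i ^ (2 * n + 2) := by
    rcases isEmpty_or_nonempty ι with h | h
    · simp [Subsingleton.elim x 0]
    · obtain ⟨i, -, hi⟩ := Finset.exists_max_image Finset.univ (fun i => ‖x i‖)
        Finset.univ_nonempty
      have : ‖x‖ = ‖x i‖ :=
        le_antisymm ((pi_norm_le_iff_of_nonneg (norm_nonneg _)).2 fun j => hi j (Finset.mem_univ j))
          (norm_le_pi_norm x i)
      rw [this, Real.norm_eq_abs, Even.pow_abs ⟨n + 1, by ring⟩]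
      exact Finset.single_le_sum (f := fun i => x i ^ (2 * n + 2))
        (fun j _ => Even.pow_nonneg ⟨n + 1, by ring⟩ _) (Finset.mem_univ i)
  unfold powerNormSq
  rw [zero_add]
  calc ‖x‖ ^ 2 = (‖x‖ ^ (2 * n + 2)) ^ (1 / ((n : ℝ) + 1)) := by
        rw [show 2 * n + 2 = 2 * (n + 1) by ring, pow_mul, ← Real.rpow_natCast (‖x‖ ^ 2),
          ← Real.rpow_mul (by positivity)]
        push_cast
        rw [mul_one_div_cancel hn.ne', Real.rpow_one]
    _ ≤ _ := by gcongr

theorem powerNormSq_le (n : ℕ) (x : ι → ℝ) :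
    powerNormSq n 0 x ≤ (Fintype.card ι : ℝ) ^ (1 / ((n : ℝ) + 1)) * ‖x‖ ^ 2 := by
  have hn : (0 : ℝ) < (n : ℝ) + 1 := by positivity
  have key : ∑ i, x i ^ (2 * n + 2) ≤ Fintype.card ι * ‖x‖ ^ (2 * n + 2) := by
    rw [← nsmul_eq_mul]
    refine Finset.sum_le_card_nsmul _ _ _ fun i _ => ?_
    rw [← Even.pow_abs ⟨n + 1, by ring⟩ (x i), ← Real.norm_eq_abs]
    gcongr
    exact norm_le_pi_norm x i
  unfold powerNormSq
  rw [zero_add]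
  have h0 := sum_even_pow_nonneg n x
  calc _ ≤ (Fintype.card ι * ‖x‖ ^ (2 * n + 2)) ^ (1 / ((n : ℝ) + 1)) := by gcongr
    _ = _ := by
        rw [Real.mul_rpow (by positivity) (by positivity)]
        congr 1
        rw [show 2 * n + 2 = 2 * (n + 1) by ring, pow_mul, ← Real.rpow_natCast (‖x‖ ^ 2),
          ← Real.rpow_mul (by positivity)]
        push_cast
        rw [mul_one_div_cancel hn.ne', Real.rpow_one]

/-- Hölder's inequality with exponents (n + 1)/n and n + 1. -/
theorem sum_pow_mul_sq_le {n : ℕ} (hn : 1 ≤ n) (u v : ι → ℝ) :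
    ∑ i, u i ^ (2 * n) * v i ^ 2 ≤
      (∑ i, u i ^ (2 * n + 2)) ^ ((n : ℝ) / (n + 1)) * powerNormSq n 0 v := by
  have hn0 : (0 : ℝ) < n := by exact_mod_cast hn
  have hn1 : (0 : ℝ) < (n : ℝ) + 1 := by positivity
  have hpq : (((n : ℝ) + 1) / n).HolderConjugate ((n : ℝ) + 1) := by
    refine Real.HolderConjugate.symm ?_
    rw [Real.holderConjugate_iff]
    constructor
    · linarith
    · field_simp
      ring
  have h := Real.inner_le_Lp_mul_Lq Finset.univ (fun i => u i ^ (2 * n)) (fun i => v i ^ 2) hpq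
  have h1 : ∀ i, |u i ^ (2 * n)| ^ (((n : ℝ) + 1) / n) = u i ^ (2 * n + 2) := by
    intro i
    rw [abs_of_nonneg (Even.pow_nonneg ⟨n, by ring⟩ _), pow_mul, ← Real.rpow_natCast (u i ^ 2) n,
      ← Real.rpow_mul (by positivity), mul_div_cancel₀ _ hn0.ne',
      show 2 * n + 2 = 2 * (n + 1) by ring, pow_mul, ← Real.rpow_natCast (u i ^ 2) (n + 1)]
    push_cast; rfl
  have h2 : ∀ i, |v i ^ 2| ^ ((n : ℝ) + 1) = v i ^ (2 * n + 2) := by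
    intro i
    rw [abs_of_nonneg (by positivity), show 2 * n + 2 = 2 * (n + 1) by ring, pow_mul,
      ← Real.rpow_natCast (v i ^ 2) (n + 1)]
    push_cast; rfl
  simp only [h1, h2] at h
  rw [one_div_div] at h
  unfold powerNormSq
  rwa [zero_add]

/-- A, B, C stand for a power sum along a line and its first two derivatives, so the left side is
the second derivative of A^(1/(n+1)). The exponent is at most 1, hence the B² term is nonpositive
and can be dropped. In the other term A^(-n/(n+1)) absorbs the Hölder factor a^(n/(n+1)). -/
theorem powerNormSq_line_second_deriv_le {n : ℕ} (hn : 1 ≤ n) {A B C V ε a : ℝ}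
    (hε : 0 < ε) (ha : 0 ≤ a) (hA : A = ε + a) (hV : 0 ≤ V)
    (hC : C ≤ (2 * n + 2) * (2 * n + 1) * (a ^ ((n : ℝ) / (n + 1)) * V)) :
    1 / ((n : ℝ) + 1) * ((1 / ((n : ℝ) + 1) - 1) * A ^ (1 / ((n : ℝ) + 1) - 1 - 1) * B * B
      + A ^ (1 / ((n : ℝ) + 1) - 1) * C) ≤ 2 * ((2 * n + 1) * V) := by
  have hn1 : (0 : ℝ) < (n : ℝ) + 1 := by positivity
  have hApos : 0 < A := by linarith
  have hexp : 1 / ((n : ℝ) + 1) - 1 = - ((n : ℝ) / (n + 1)) := by field_simp; ring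
  have hneg : (1 / ((n : ℝ) + 1) - 1) * A ^ (1 / ((n : ℝ) + 1) - 1 - 1) * B * B ≤ 0 := by
    rw [mul_assoc, mul_assoc]
    refine mul_nonpos_of_nonpos_of_nonneg ?_ (mul_nonneg (by positivity) (mul_self_nonneg B))
    rw [hexp]
    have : 0 ≤ (n : ℝ) / (n + 1) := by positivity
    linarith
  have hle : A ^ (1 / ((n : ℝ) + 1) - 1) * a ^ ((n : ℝ) / (n + 1)) ≤ 1 := by
    rw [hexp, Real.rpow_neg hApos.le, inv_mul_le_iff₀ (by positivity), mul_one]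
    exact Real.rpow_le_rpow ha (by linarith) (by positivity)
  have h2 : A ^ (1 / ((n : ℝ) + 1) - 1) * C ≤ (2 * n + 2) * (2 * n + 1) * V := by
    calc A ^ (1 / ((n : ℝ) + 1) - 1) * C
        ≤ A ^ (1 / ((n : ℝ) + 1) - 1) *
          ((2 * n + 2) * (2 * n + 1) * (a ^ ((n : ℝ) / (n + 1)) * V)) := by gcongr
      _ = (A ^ (1 / ((n : ℝ) + 1) - 1) * a ^ ((n : ℝ) / (n + 1))) *
          ((2 * n + 2) * (2 * n + 1) * V) := by ring
      _ ≤ 1 * ((2 * n + 2) * (2 * n + 1) * V) := by gcongr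
      _ = _ := one_mul _
  calc _ ≤ 1 / ((n : ℝ) + 1) * ((2 * n + 2) * (2 * n + 1) * V) := by gcongr; linarith
    _ = _ := by field_simp

/-- Smoothness of the squared `ℓ_p` norm, `p = 2 n + 2`. -/
theorem exists_powerNormSq_add_le {n : ℕ} (hn : 1 ≤ n) {ε : ℝ} (hε : 0 < ε) (x : ι → ℝ) :
    ∃ g : ι → ℝ, ∀ v : ι → ℝ, powerNormSq n ε (x + v) ≤
      powerNormSq n ε x + ∑ i, g i * v i + (2 * n + 1) * powerNormSq n 0 v := by
  set α : ℝ := 1 / ((n : ℝ) + 1) with hα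
  -- The witness is the gradient at x. The regularization ε > 0 keeps the base positive, so its
  -- powers are differentiable even where the sum vanishes.
  refine ⟨fun i => α * (ε + ∑ j, x j ^ (2 * n + 2)) ^ (α - 1) *
    ((2 * n + 2 : ℕ) * x i ^ (2 * n + 1)), fun v => ?_⟩
  have hV := powerNormSq_nonneg n le_rfl v
  set A : ℝ → ℝ := fun s => ε + ∑ i, (x i + s * v i) ^ (2 * n + 2) with hA
  set A' : ℝ → ℝ := fun s => ∑ i, (2 * n + 2 : ℕ) * (x i + s * v i) ^ (2 * n + 1) * v i with hA'
  set A'' : ℝ → ℝ := fun s => ∑ i, (2 * n + 2 : ℕ) * ((2 * n + 1 : ℕ) *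
    (x i + s * v i) ^ (2 * n) * v i) * v i with hA''
  have hApos : ∀ s, 0 < A s := fun s =>
    add_pos_of_pos_of_nonneg hε (sum_even_pow_nonneg n fun i => x i + s * v i)
  have hlin : ∀ i s, HasDerivAt (fun s => x i + s * v i) (v i) s := fun i s => by
    simpa using ((hasDerivAt_id s).mul_const (v i)).const_add (x i)
  have hdA : ∀ s, HasDerivAt A (A' s) s := fun s => by
    refine HasDerivAt.const_add ε (HasDerivAt.fun_sum fun i _ => ?_)
    simpa using (hlin i s).fun_pow (2 * n + 2)
  have hdA' : ∀ s, HasDerivAt A' (A'' s) s := fun s => by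
    refine HasDerivAt.fun_sum fun i _ => ?_
    refine HasDerivAt.mul_const (HasDerivAt.const_mul _ ?_) _
    simpa using (hlin i s).fun_pow (2 * n + 1)
  set φ' : ℝ → ℝ := fun s => α * (A s ^ (α - 1) * A' s) with hφ'
  have hd1 : ∀ s, HasDerivAt (fun s => A s ^ α) (φ' s) s := fun s =>
    ((hdA s).rpow_const (Or.inl (hApos s).ne')).congr_deriv (by simp only [hφ']; ring)
  have hd2 : ∀ s, HasDerivAt φ' (α * ((α - 1) * A s ^ (α - 1 - 1) * A' s * A' s
      + A s ^ (α - 1) * A'' s)) s := fun s =>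
    (((hdA s).rpow_const (p := α - 1) (Or.inl (hApos s).ne')).mul (hdA' s)).const_mul α
      |>.congr_deriv (by ring)
  have hbd : ∀ s, α * ((α - 1) * A s ^ (α - 1 - 1) * A' s * A' s + A s ^ (α - 1) * A'' s) ≤
      2 * ((2 * n + 1) * powerNormSq n 0 v) := fun s => by
    refine powerNormSq_line_second_deriv_le hn hε
      (sum_even_pow_nonneg n fun i => x i + s * v i) rfl hV ?_
    calc A'' s = (2 * n + 2) * (2 * n + 1) * ∑ i, (x i + s * v i) ^ (2 * n) * v i ^ 2 := by
          simp only [hA'', Finset.mul_sum]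
          refine Finset.sum_congr rfl fun i _ => ?_
          push_cast; ring
      _ ≤ _ := by
          gcongr
          exact sum_pow_mul_sq_le hn _ v
  have hanti : Antitone fun s => φ' s - 2 * ((2 * n + 1) * powerNormSq n 0 v) * s := by
    have hd3 : ∀ s, HasDerivAt (fun s => φ' s - 2 * ((2 * n + 1) * powerNormSq n 0 v) * s)
        (_ - 2 * ((2 * n + 1) * powerNormSq n 0 v) * 1) s := fun s =>
      (hd2 s).sub ((hasDerivAt_id s).const_mul _)
    refine antitone_of_deriv_nonpos (fun s => (hd3 s).differentiableAt) fun s => ?_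
    rw [(hd3 s).deriv]
    linarith [hbd s]
  have h := le_taylor_of_deriv_le (φ := fun s => A s ^ α) (fun s _ => hd1 s)
    (M := (2 * n + 1) * powerNormSq n 0 v) (fun s hs => by
      have := hanti hs.1
      simp only [mul_zero, sub_zero] at this
      linarith)
  have e0 : A 0 = ε + ∑ i, x i ^ (2 * n + 2) := by simp [hA]
  have e1 : A 1 ^ α = powerNormSq n ε (x + v) := by simp [hA, powerNormSq, hα]
  have e2 : φ' 0 = ∑ i, α * (ε + ∑ j, x j ^ (2 * n + 2)) ^ (α - 1) *
    ((2 * n + 2 : ℕ) * x i ^ (2 * n + 1)) * v i := by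
    simp only [hφ', e0, hA', zero_mul, add_zero, Finset.mul_sum]
    refine Finset.sum_congr rfl fun i _ => by ring
  rw [← e2, ← e1]
  simpa [e0, powerNormSq, hα] using h

end PowerNorm

/-! ### Duality of the ℓ₁ and ℓ_∞ norms -/

section Norms

variable {d : ℕ}

theorem l1Norm_nonneg (x : Vec d) : 0 ≤ l1Norm x := Finset.sum_nonneg fun _ _ => abs_nonneg _

@[simp] theorem l1Norm_zero : l1Norm (0 : Vec d) = 0 := by simp [l1Norm]

theorem l1Norm_neg (x : Vec d) : l1Norm (-x) = l1Norm x := by simp [l1Norm]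

theorem l1Norm_sub_comm (x y : Vec d) : l1Norm (x - y) = l1Norm (y - x) := by
  rw [← l1Norm_neg, neg_sub]

theorem l1Norm_add_le (x y : Vec d) : l1Norm (x + y) ≤ l1Norm x + l1Norm y := by
  simp only [l1Norm, ← Finset.sum_add_distrib]
  exact Finset.sum_le_sum fun i _ => abs_add_le _ _

theorem l1Norm_smul (r : ℝ) (x : Vec d) : l1Norm (r • x) = |r| * l1Norm x := by
  simp [l1Norm, abs_mul, Finset.mul_sum]

theorem continuous_l1Norm : Continuous (l1Norm : Vec d → ℝ) := by
  unfold l1Norm; fun_prop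

theorem l1Norm_add_smul_lt_of_lt {x y : Vec d} {r s ρ : ℝ} (hr : 0 ≤ r) (hs : 0 ≤ s)
    (hrs : r + s = 1) (hx : l1Norm x < ρ) (hy : l1Norm y < ρ) : l1Norm (r • x + s • y) < ρ := by
  have h := l1Norm_add_le (r • x) (s • y)
  rw [l1Norm_smul, l1Norm_smul, abs_of_nonneg hr, abs_of_nonneg hs] at h
  rcases hr.eq_or_lt with rfl | hr
  · obtain rfl : s = 1 := by linarith
    simpa using hy
  · have h1 := mul_lt_mul_of_pos_left hx hr
    have h2 := mul_le_mul_of_nonneg_left hy.le hs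
    have h3 : r * ρ + s * ρ = ρ := by rw [← add_mul, hrs, one_mul]
    linarith

theorem l1Norm_add_smul_le_of_le {x y : Vec d} {r s ρ : ℝ} (hr : 0 ≤ r) (hs : 0 ≤ s)
    (hrs : r + s = 1) (hx : l1Norm x ≤ ρ) (hy : l1Norm y ≤ ρ) : l1Norm (r • x + s • y) ≤ ρ := by
  have h := l1Norm_add_le (r • x) (s • y)
  rw [l1Norm_smul, l1Norm_smul, abs_of_nonneg hr, abs_of_nonneg hs] at h
  obtain rfl : s = 1 - r := by linarith
  nlinarith

theorem norm_le_l1Norm (x : Vec d) : ‖x‖ ≤ l1Norm x := by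
  rw [EuclideanSpace.norm_eq]
  refine Real.sqrt_le_iff.2 ⟨l1Norm_nonneg x, ?_⟩
  exact Finset.sum_sq_le_sq_sum_of_nonneg fun i _ => norm_nonneg (x i)

theorem linfNorm_nonneg (x : Vec d) : 0 ≤ linfNorm x := norm_nonneg _

theorem linfNorm_neg (x : Vec d) : linfNorm (-x) = linfNorm x := norm_neg _

theorem linfNorm_add_le (x y : Vec d) : linfNorm (x + y) ≤ linfNorm x + linfNorm y :=
  norm_add_le _ _

theorem linfNorm_sub_le (x y : Vec d) : linfNorm (x - y) ≤ linfNorm x + linfNorm y :=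
  norm_sub_le _ _

theorem linfNorm_smul (r : ℝ) (x : Vec d) : linfNorm (r • x) = |r| * linfNorm x :=
  norm_smul _ _

theorem continuous_linfNorm : Continuous (linfNorm : Vec d → ℝ) := by
  unfold linfNorm; fun_prop

theorem linfNorm_le_l1Norm (x : Vec d) : linfNorm x ≤ l1Norm x :=
  (pi_norm_le_iff_of_nonneg (l1Norm_nonneg x)).2 fun i =>
    Finset.single_le_sum (f := fun i => |x i|) (fun _ _ => abs_nonneg _) (Finset.mem_univ i)

theorem abs_inner_le_linfNorm_mul_l1Norm (x y : Vec d) :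
    |inner ℝ x y| ≤ linfNorm x * l1Norm y := by
  simp only [PiLp.inner_apply, l1Norm, Finset.mul_sum]
  refine (Finset.abs_sum_le_sum_abs _ _).trans (Finset.sum_le_sum fun i _ => ?_)
  simp only [RCLike.inner_apply, conj_trivial, abs_mul]
  rw [mul_comm]
  exact mul_le_mul_of_nonneg_right (norm_le_pi_norm (WithLp.ofLp x) i) (abs_nonneg _)

/-- The dual of the `ℓ₁`-ball is the `ℓ_∞`-norm. -/
theorem mul_linfNorm_le_of_forall_inner_le {u : Vec d} {ρ c : ℝ} (hρ : 0 ≤ ρ)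
    (hc : 0 ≤ c) (h : ∀ z, l1Norm z ≤ ρ → inner ℝ u z ≤ c) : ρ * linfNorm u ≤ c := by
  rcases hρ.eq_or_lt with rfl | hρ
  · simpa using hc
  rw [mul_comm, ← le_div_iff₀ hρ]
  refine (pi_norm_le_iff_of_nonneg (by positivity)).2 fun i => ?_
  rw [le_div_iff₀ hρ, Real.norm_eq_abs]
  -- The extreme points ±ρeᵢ of the ball recover each |uᵢ|.
  have hs : ∀ r : ℝ, |r| = ρ → inner ℝ u (EuclideanSpace.single i r) ≤ c := fun r hr => by
    refine h _ ?_
    unfold l1Norm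
    rw [Finset.sum_eq_single i (fun j _ hj => by simp [hj]) (by simp)]
    simp [hr]
  have h1 := hs ρ (abs_of_pos hρ)
  have h2 := hs (-ρ) (by rw [abs_neg, abs_of_pos hρ])
  simp only [EuclideanSpace.inner_single_right, conj_trivial] at h1 h2
  rcases abs_cases (u i) with ⟨h, _⟩ | ⟨h, _⟩ <;> rw [h] <;> linarith

end Norms

/-! ### The proximal step as a projection, and its measurability -/

section Prox

variable {d : ℕ} {X : Set (Vec d)} {ψ : ℝ}

/-- The variational inequality characterizing the point `p` of `X ∩ (a + l1Ball d ψ)` nearest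
to `v`. -/
structure IsBallProj (X : Set (Vec d)) (ψ : ℝ) (a v p : Vec d) : Prop where
  mem : p ∈ X
  l1Norm_le : l1Norm (p - a) ≤ ψ
  inner_nonneg : ∀ y ∈ X, l1Norm (y - a) ≤ ψ → 0 ≤ inner ℝ (p - v) (y - p)

theorem convex_inter_l1Ball (hX : Convex ℝ X) (a : Vec d) :
    Convex ℝ {y | y ∈ X ∧ l1Norm (y - a) ≤ ψ} := by
  intro y hy z hz r s hr hs hrs
  refine ⟨hX hy.1 hz.1 hr hs hrs, ?_⟩
  have : r • y + s • z - a = r • (y - a) + s • (z - a) := by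
    have : a = (r + s) • a := by rw [hrs, one_smul]
    nth_rw 1 [this]
    module
  rw [this]
  exact l1Norm_add_smul_le_of_le hr hs hrs hy.2 hz.2

theorem isBallProj_of_norm_le (hX : Convex ℝ X) {a v p : Vec d}
    (hp : p ∈ X) (hpa : l1Norm (p - a) ≤ ψ)
    (h : ∀ y ∈ X, l1Norm (y - a) ≤ ψ → ‖v - p‖ ≤ ‖v - y‖) : IsBallProj X ψ a v p := by
  refine ⟨hp, hpa, fun y hy hya => ?_⟩
  have hmem : p ∈ {y | y ∈ X ∧ l1Norm (y - a) ≤ ψ} := ⟨hp, hpa⟩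
  have : Nonempty {y | y ∈ X ∧ l1Norm (y - a) ≤ ψ} := ⟨⟨p, hmem⟩⟩
  have := (norm_eq_iInf_iff_real_inner_le_zero (convex_inter_l1Ball hX a) (u := v) hmem).1
    (le_antisymm (le_ciInf fun w => h w w.2.1 w.2.2)
      (ciInf_le ⟨0, by rintro _ ⟨w, rfl⟩; exact norm_nonneg _⟩
        (⟨p, hmem⟩ : {y | y ∈ X ∧ l1Norm (y - a) ≤ ψ}))) y ⟨hy, hya⟩
  rw [← neg_sub v p, inner_neg_left]
  linarith

theorem exists_isBallProj (hXc : IsClosed X) (hX : Convex ℝ X) (hψ : 0 ≤ ψ) {a : Vec d}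
    (ha : a ∈ X) (v : Vec d) : ∃ p, IsBallProj X ψ a v p := by
  have hcl : IsClosed {y | y ∈ X ∧ l1Norm (y - a) ≤ ψ} :=
    hXc.inter (isClosed_le (continuous_l1Norm.comp (continuous_id.sub continuous_const))
      continuous_const)
  have hne : {y | y ∈ X ∧ l1Norm (y - a) ≤ ψ}.Nonempty := ⟨a, ha, by simpa using hψ⟩
  obtain ⟨p, hp, h⟩ := exists_norm_eq_iInf_of_complete_convex hne hcl.isComplete (convex_inter_l1Ball hX a) v
  refine ⟨p, isBallProj_of_norm_le hX hp.1 hp.2 fun y hy hya => ?_⟩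
  rw [h]
  exact ciInf_le ⟨0, by rintro _ ⟨w, rfl⟩; exact norm_nonneg _⟩
    (⟨y, hy, hya⟩ : {y | y ∈ X ∧ l1Norm (y - a) ≤ ψ})

theorem IsProxPoint.isBallProj (hX : Convex ℝ X) (hψ : 0 ≤ ψ) {a v p : Vec d} (ha : a ∈ X)
    (h : IsProxPoint X (indicatorFn (l1Ball d ψ)) a v p) : IsBallProj X ψ a v p := by
  obtain ⟨hp, hmin⟩ := h
  have hpa : l1Norm (p - a) ≤ ψ := by
    by_contra hcon
    -- The center a has a finite objective value, so the minimal value is not +∞.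
    have h1 := hmin ha
    have e1 : indicatorFn (l1Ball d ψ) (p - a) = ⊤ := if_neg hcon
    have e2 : indicatorFn (l1Ball d ψ) (a - a) = 0 := if_pos (by simpa [l1Ball] using hψ)
    simp only [Set.mem_ofPred_eq, e1, e2, add_zero, EReal.coe_add_top, top_le_iff] at h1
    exact EReal.coe_ne_top _ h1
  refine isBallProj_of_norm_le hX hp hpa fun y hy hya => ?_
  have h1 := hmin hy
  have e1 : indicatorFn (l1Ball d ψ) (p - a) = 0 := if_pos hpa
  have e2 : indicatorFn (l1Ball d ψ) (y - a) = 0 := if_pos hya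
  simp only [Set.mem_ofPred_eq, e1, e2, add_zero, EReal.coe_le_coe_iff] at h1
  rw [norm_sub_rev v p, norm_sub_rev v y]
  exact (pow_le_pow_iff_left₀ (norm_nonneg _) (norm_nonneg _) two_ne_zero).1 (by linarith)

/-- A point feasible for the ball about a' need not be feasible for the ball about a. Its distance
to a is at most ψ + δ, δ = ‖a' - a‖₁, and pulling it toward a scales that distance by ψ/(ψ + δ). By
convexity the pulled point stays in X, so it can be tested in the variational inequality at a. -/
theorem l1Norm_contract_le {a a' p' : Vec d} (hψ : 0 < ψ) (hp' : l1Norm (p' - a') ≤ ψ) :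
    l1Norm (p' + (l1Norm (a' - a) / (ψ + l1Norm (a' - a))) • (a - p') - a) ≤ ψ := by
  have hδ := l1Norm_nonneg (a' - a)
  set δ := l1Norm (a' - a)
  have h1 : p' + (δ / (ψ + δ)) • (a - p') - a = (ψ / (ψ + δ)) • ((p' - a') + (a' - a)) := by
    have : ψ / (ψ + δ) = 1 - δ / (ψ + δ) := by field_simp; ring
    rw [this]; module
  rw [h1, l1Norm_smul, abs_of_nonneg (by positivity)]
  calc ψ / (ψ + δ) * l1Norm (p' - a' + (a' - a)) ≤ ψ / (ψ + δ) * (ψ + δ) := by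
        gcongr
        exact (l1Norm_add_le _ _).trans (add_le_add hp' le_rfl)
    _ = ψ := by field_simp

theorem IsBallProj.inner_contract_nonneg (hX : Convex ℝ X) (hψ : 0 < ψ) {a v p a' v' p' : Vec d}
    (ha : a ∈ X) (h : IsBallProj X ψ a v p) (h' : IsBallProj X ψ a' v' p') :
    0 ≤ inner ℝ (p - v) (p' - p) +
      l1Norm (a' - a) / (ψ + l1Norm (a' - a)) * (‖p - v‖ * (‖a' - a‖ + ψ)) := by
  have hδ := l1Norm_nonneg (a' - a)
  have h1 := h.inner_nonneg _ (hX.add_smul_sub_mem h'.mem ha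
    (t := l1Norm (a' - a) / (ψ + l1Norm (a' - a)))
    ⟨by positivity, (div_le_one (by positivity)).2 (by linarith)⟩)
    (l1Norm_contract_le hψ h'.l1Norm_le)
  rw [add_sub_right_comm, inner_add_right, inner_smul_right] at h1
  refine h1.trans ?_
  gcongr
  refine (real_inner_le_norm _ _).trans ?_
  gcongr
  calc ‖a - p'‖ = ‖(a' - a) + (p' - a')‖ := by rw [norm_sub_rev]; congr 1; abel
    _ ≤ _ := (norm_add_le _ _).trans
      (add_le_add le_rfl ((norm_le_l1Norm _).trans h'.l1Norm_le))

/-- The two variational inequalities are added, as for nonexpansiveness of projections, each point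
being contracted to become feasible for the other problem. The bound tends to 0 as (a', v') → (a,
v), which gives continuity of the projection, and is 0 for equal data, which gives uniqueness. -/
theorem IsBallProj.sq_dist_le (hX : Convex ℝ X) (hψ : 0 < ψ) {a v p a' v' p' : Vec d}
    (ha : a ∈ X) (ha' : a' ∈ X) (h : IsBallProj X ψ a v p) (h' : IsBallProj X ψ a' v' p') :
    ‖p' - p‖ ^ 2 ≤ ‖v' - v‖ * (‖a' - a‖ + 2 * ψ) +
      l1Norm (a' - a) / (ψ + l1Norm (a' - a)) *
        (((‖a - v‖ + ψ) + (‖a' - v'‖ + ψ)) * (‖a' - a‖ + ψ)) := by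
  have hδ := l1Norm_nonneg (a' - a)
  have h1 := h.inner_contract_nonneg hX hψ ha h'
  have h2 := h'.inner_contract_nonneg hX hψ ha' h
  rw [l1Norm_sub_comm a a', norm_sub_rev a a'] at h2
  have hpv : ∀ {a v p : Vec d}, IsBallProj X ψ a v p → ‖p - v‖ ≤ ‖a - v‖ + ψ := fun {a v p} h => by
    calc ‖p - v‖ = ‖(a - v) + (p - a)‖ := by congr 1; abel
      _ ≤ _ := (norm_add_le _ _).trans
        (add_le_add le_rfl ((norm_le_l1Norm _).trans h.l1Norm_le))
  have hpp : ‖p' - p‖ ≤ ‖a' - a‖ + 2 * ψ := by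
    calc ‖p' - p‖ = ‖(a' - a) + (p' - a') - (p - a)‖ := by congr 1; abel
      _ ≤ ‖a' - a‖ + ‖p' - a'‖ + ‖p - a‖ := (norm_sub_le _ _).trans (add_le_add (norm_add_le _ _) le_rfl)
      _ ≤ _ := by
        have := (norm_le_l1Norm _).trans h.l1Norm_le
        have := (norm_le_l1Norm _).trans h'.l1Norm_le
        linarith
  have key : ‖p' - p‖ ^ 2 = inner ℝ (v' - v) (p' - p) -
      (inner ℝ (p - v) (p' - p) + inner ℝ (p' - v') (p - p')) := by
    rw [← real_inner_self_eq_norm_sq, ← neg_sub p' p, inner_neg_right, ← sub_eq_add_neg,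
      ← inner_sub_left, ← inner_sub_left]
    congr 1; abel
  have hv : inner ℝ (v' - v) (p' - p) ≤ ‖v' - v‖ * (‖a' - a‖ + 2 * ψ) :=
    (real_inner_le_norm _ _).trans (by gcongr)
  have h3 : l1Norm (a' - a) / (ψ + l1Norm (a' - a)) * (‖p - v‖ * (‖a' - a‖ + ψ)) +
      l1Norm (a' - a) / (ψ + l1Norm (a' - a)) * (‖p' - v'‖ * (‖a' - a‖ + ψ)) ≤
      l1Norm (a' - a) / (ψ + l1Norm (a' - a)) *
        (((‖a - v‖ + ψ) + (‖a' - v'‖ + ψ)) * (‖a' - a‖ + ψ)) := by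
    rw [← mul_add, ← add_mul]
    gcongr
    · exact hpv h
    · exact hpv h'
  rw [key]
  linarith

/-- The proximal point depends measurably on the current iterate and on the gradient step. -/
theorem measurable_of_isBallProj (hXc : IsClosed X) (hX : Convex ℝ X) (hψ : 0 < ψ)
    {Ω : Type*} {m : MeasurableSpace Ω} {a v p : Ω → Vec d} (ha : Measurable a) (hv : Measurable v)
    (haX : ∀ ω, a ω ∈ X) (h : ∀ ω, IsBallProj X ψ (a ω) (v ω) (p ω)) : Measurable p := by
  choose T hT using fun w : X × Vec d => exists_isBallProj hXc hX hψ.le w.1.2 w.2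
  have hcont : Continuous T := by
    rw [continuous_iff_continuousAt]
    intro w
    rw [ContinuousAt, tendsto_iff_norm_sub_tendsto_zero]
    set g : X × Vec d → ℝ := fun w' => ‖w'.2 - w.2‖ * (‖(w'.1 : Vec d) - (w.1 : Vec d)‖ + 2 * ψ) +
      l1Norm ((w'.1 : Vec d) - (w.1 : Vec d)) / (ψ + l1Norm ((w'.1 : Vec d) - (w.1 : Vec d))) *
        (((‖(w.1 : Vec d) - w.2‖ + ψ) + (‖(w'.1 : Vec d) - w'.2‖ + ψ)) *
          (‖(w'.1 : Vec d) - (w.1 : Vec d)‖ + ψ)) with hg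
    have hgc : Continuous g := by
      have hl : Continuous fun w' : X × Vec d => l1Norm ((w'.1 : Vec d) - (w.1 : Vec d)) :=
        continuous_l1Norm.comp (by fun_prop)
      have hne : ∀ w' : X × Vec d, ψ + l1Norm ((w'.1 : Vec d) - (w.1 : Vec d)) ≠ 0 := fun w' =>
        (add_pos_of_pos_of_nonneg hψ (l1Norm_nonneg _)).ne'
      have hd : Continuous fun w' : X × Vec d =>
          l1Norm ((w'.1 : Vec d) - (w.1 : Vec d)) / (ψ + l1Norm ((w'.1 : Vec d) - (w.1 : Vec d))) :=
        hl.div (continuous_const.add hl) hne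
      exact Continuous.add (by fun_prop) (hd.mul (by fun_prop))
    have hg0 : Tendsto (fun w' => Real.sqrt (g w')) (𝓝 w) (𝓝 0) := by
      have := (Real.continuous_sqrt.comp hgc).tendsto w
      simpa [hg, Function.comp_def] using this
    refine squeeze_zero (fun _ => norm_nonneg _) (fun w' => ?_) hg0
    exact Real.le_sqrt_of_sq_le ((hT w).sq_dist_le hX hψ w.1.2 w'.1.2 (hT w'))
  have hp : p = fun ω => T (⟨a ω, haX ω⟩, v ω) := by
    funext ω
    have := (h ω).sq_dist_le hX hψ (haX ω) (haX ω) (hT (⟨a ω, haX ω⟩, v ω))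
    simp only [sub_self, norm_zero, zero_mul, l1Norm_zero, zero_div, add_zero] at this
    have h0 : ‖T (⟨a ω, haX ω⟩, v ω) - p ω‖ = 0 :=
      pow_eq_zero_iff two_ne_zero |>.1 (le_antisymm this (by positivity))
    exact (sub_eq_zero.1 (norm_eq_zero.1 h0)).symm
  rw [hp]
  exact hcont.measurable.comp ((ha.subtype_mk).prodMk hv)

end Prox

/-! ### Normal cone of X intersected with an ℓ₁-ball -/

section NormalCone

variable {d : ℕ} {X : Set (Vec d)} {ψ : ℝ}

theorem le_of_forall_add_mul_le {A B c : ℝ} (h : ∀ θ, 0 ≤ θ → θ < 1 → A + θ * B ≤ c) :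
    A + B ≤ c := by
  have ht : Tendsto (fun θ : ℝ => A + θ * B) (𝓝[<] 1) (𝓝 (A + 1 * B)) :=
    ((by fun_prop : Continuous fun θ : ℝ => A + θ * B).tendsto 1).mono_left nhdsWithin_le_nhds
  rw [one_mul] at ht
  refine le_of_tendsto ht ?_
  filter_upwards [Ioo_mem_nhdsLT (zero_lt_one' ℝ)] with θ hθ using h θ hθ.1.le hθ.2

/-- The sum rule for the normal cone of `X ∩ (a + l1Ball d ψ)`, the center `a` of the ball being a
point of `X`. -/
theorem exists_normal_of_inner_nonneg (hX : Convex ℝ X) (hψ : 0 < ψ) {a p w : Vec d} (ha : a ∈ X)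
    (hp : p ∈ X) (hpa : l1Norm (p - a) ≤ ψ)
    (hw : ∀ y ∈ X, l1Norm (y - a) ≤ ψ → 0 ≤ inner ℝ w (y - p)) :
    ∃ n : Vec d, (∀ y ∈ X, inner ℝ n (y - p) ≤ 0) ∧
      ψ * linfNorm (w + n) ≤ - inner ℝ (w + n) (p - a) := by
  -- The open set above the interior of the ball is separated from the hypograph over X of -⟨w, y -
  -- p⟩; `hw` makes that function nonpositive on the common part.
  set S : Set (Vec d × ℝ) := {z | l1Norm (z.1 - a) < ψ ∧ 0 < z.2}
  set R : Set (Vec d × ℝ) := {z | z.1 ∈ X ∧ z.2 ≤ - inner ℝ w (z.1 - p)}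
  have hSc : Convex ℝ S := by
    rintro ⟨y, α⟩ ⟨hy, hα⟩ ⟨z, β⟩ ⟨hz, hβ⟩ r s hr hs hrs
    refine ⟨?_, ?_⟩
    · have : r • y + s • z - a = r • (y - a) + s • (z - a) := by
        have : a = (r + s) • a := by rw [hrs, one_smul]
        nth_rw 1 [this]
        module
      change l1Norm (r • y + s • z - a) < ψ
      rw [this]
      exact l1Norm_add_smul_lt_of_lt hr hs hrs hy hz
    · exact (convex_Ioi (0 : ℝ)) hα hβ hr hs hrs
  have hSo : IsOpen S :=
    (isOpen_lt (continuous_l1Norm.comp (by fun_prop)) continuous_const).inter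
      (isOpen_lt continuous_const continuous_snd)
  have hRc : Convex ℝ R := by
    rintro ⟨y, α⟩ ⟨hy, hα⟩ ⟨z, β⟩ ⟨hz, hβ⟩ r s hr hs hrs
    refine ⟨hX hy hz hr hs hrs, ?_⟩
    have : r • y + s • z - p = r • (y - p) + s • (z - p) := by
      have : p = (r + s) • p := by rw [hrs, one_smul]
      nth_rw 1 [this]
      module
    change r * α + s * β ≤ - inner ℝ w (r • y + s • z - p)
    rw [this, inner_add_right, inner_smul_right, inner_smul_right]
    have h1 := mul_le_mul_of_nonneg_left hα hr
    have h2 := mul_le_mul_of_nonneg_left hβ hs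
    simp only at h1 h2
    linarith
  have hdisj : Disjoint S R := by
    rw [Set.disjoint_left]
    rintro ⟨y, α⟩ ⟨hy, hα⟩ ⟨hyX, hα'⟩
    have := hw y hyX hy.le
    simp only at hα hα'
    linarith
  obtain ⟨f, c, hfS, hfR⟩ := geometric_hahn_banach_open hSc hSo hRc hdisj
  set u : Vec d := (InnerProductSpace.toDual ℝ (Vec d)).symm
    (f.comp (ContinuousLinearMap.inl ℝ (Vec d) ℝ)) with hu
  set γ : ℝ := - f (0, 1) with hγ
  have hf : ∀ z α, f (z, α) = inner ℝ u z - γ * α := fun z α => by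
    have h1 : ((z, α) : Vec d × ℝ) = (z, 0) + α • (0, 1) := by simp
    rw [h1, map_add, map_smul, hu, InnerProductSpace.toDual_symm_apply, hγ]
    simp [mul_comm]
  have hS : ∀ z α, l1Norm (z - a) < ψ → 0 < α → inner ℝ u z - γ * α < c := fun z α hz hα => by
    rw [← hf]; exact hfS _ ⟨hz, hα⟩
  have hR : ∀ y ∈ X, c ≤ inner ℝ u y + γ * inner ℝ w (y - p) := fun y hy => by
    have := hfR (y, - inner ℝ w (y - p)) ⟨hy, le_rfl⟩
    rw [hf] at this
    linarith
  have hRp : c ≤ inner ℝ u p := by simpa using hR p hp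
  -- A negative γ is impossible because the second coordinate is unbounded above in S.
  have hγ0 : 0 ≤ γ := by
    by_contra hneg
    push Not at hneg
    have h1 := hS a (((inner ℝ u a - c) / γ) ⊔ 1) (by simpa using hψ) (by positivity)
    have hle : γ * (((inner ℝ u a - c) / γ) ⊔ 1) ≤ inner ℝ u a - c := by
      calc _ ≤ γ * ((inner ℝ u a - c) / γ) := mul_le_mul_of_nonpos_left (le_max_left _ _) hneg.le
        _ = _ := mul_div_cancel₀ _ hneg.ne
    linarith
  -- Slater's condition: a lies in X and in the open ball, so a vertical hyperplane would contradict
  -- strict separation there.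
  have hγpos : 0 < γ := by
    rcases hγ0.eq_or_lt with h | h
    · have h1 := hS a 1 (by simpa using hψ) one_pos
      have h2 := hR a ha
      rw [← h, zero_mul] at h1 h2
      linarith
    · exact h
  -- Passage to the closed ball: points are pulled toward a by θ < 1, and the second coordinate
  -- tends to 0.
  have hSz : ∀ z, l1Norm (z - a) ≤ ψ → inner ℝ u z ≤ c := fun z hz => by
    have h1 : inner ℝ u a + inner ℝ u (z - a) ≤ c := by
      refine le_of_forall_add_mul_le fun θ hθ0 hθ1 => ?_
      refine le_of_forall_pos_le_add fun ε hε => ?_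
      have h2 := hS (a + θ • (z - a)) (ε / γ) (by
        rw [add_sub_cancel_left, l1Norm_smul, abs_of_nonneg hθ0]
        nlinarith [l1Norm_nonneg (z - a)]) (by positivity)
      rw [inner_add_right, inner_smul_right, mul_div_cancel₀ _ hγpos.ne'] at h2
      linarith
    rwa [← inner_add_right, add_sub_cancel] at h1
  have hc : c = inner ℝ u p := le_antisymm hRp (hSz p hpa)
  -- With this n, w + n = -u/γ, and u attains its maximum over the ball at p.
  refine ⟨-(γ⁻¹ • u + w), fun y hy => ?_, ?_⟩
  · have h1 := hR y hy
    rw [hc] at h1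
    have h2 : inner ℝ u y = inner ℝ u p + inner ℝ u (y - p) := by
      rw [← inner_add_right, add_sub_cancel]
    rw [inner_neg_left, inner_add_left, real_inner_smul_left]
    have h3 : 0 ≤ γ⁻¹ * (inner ℝ u (y - p) + γ * inner ℝ w (y - p)) :=
      mul_nonneg (by positivity) (by linarith)
    rw [mul_add, inv_mul_cancel_left₀ hγpos.ne'] at h3
    linarith
  · have e : w + -(γ⁻¹ • u + w) = -(γ⁻¹ • u) := by abel
    rw [e, linfNorm_neg, linfNorm_smul, inner_neg_left, neg_neg, real_inner_smul_left,
      abs_of_nonneg (by positivity), mul_left_comm]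
    have hz : ∀ z, l1Norm z ≤ ψ → inner ℝ u z ≤ inner ℝ u (p - a) := fun z hz => by
      have h1 := hSz (a + z) (by simpa using hz)
      rw [hc, inner_add_right] at h1
      rw [inner_sub_right]
      linarith
    gcongr
    exact mul_linfNorm_le_of_forall_inner_le hψ.le (by simpa using hz 0 (by simpa using hψ.le)) hz

end NormalCone

/-! ### One proximal step -/

section OneStep

variable {d : ℕ} {X : Set (Vec d)} {f : Vec d → ℝ}

/-- Off X the function is +∞; on X the normal vector only lowers the linear minorant. This inclusion
suffices, since an infimum is to be bounded from above. -/
theorem add_mem_subdifferential {p n : Vec d} (hf : DifferentiableAt ℝ f p) (hp : p ∈ X)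
    (hn : ∀ y ∈ X, inner ℝ n (y - p) ≤ 0) :
    gradient f p + n ∈ subdifferential (fun y => (f y : EReal) + indicatorFn X y) p := by
  have e : ∀ y ∈ X, (f y : EReal) + indicatorFn X y = f y := fun y hy => by
    rw [indicatorFn, if_pos hy, add_zero]
  refine ⟨by simp [e p hp], by simp [e p hp], fun ε hε => ?_⟩
  have ho := (hasGradientAt_iff_isLittleO.1 hf.hasGradientAt).def hε
  filter_upwards [ho] with y hy
  by_cases hyX : y ∈ X
  · simp only [e p hp, e y hyX, ← EReal.coe_add, EReal.coe_le_coe_iff]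
    rw [Real.norm_eq_abs] at hy
    have := (abs_le.1 hy).1
    rw [inner_add_left]
    linarith [hn y hyX]
  · have : indicatorFn X y = ⊤ := if_neg hyX
    simp [this]

theorem residual_le {p n : Vec d} (hf : DifferentiableAt ℝ f p) (hp : p ∈ X)
    (hn : ∀ y ∈ X, inner ℝ n (y - p) ≤ 0) :
    residual f X p ≤ ENNReal.ofReal (linfNorm (gradient f p + n)) :=
  iInf₂_le _ (add_mem_subdifferential hf hp hn)

/-- The descent lemma for the ℓ₁/ℓ_∞ pairing: along the segment the derivative grows with slope at
most L‖p - a‖₁². -/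
theorem le_add_inner_gradient {L : ℝ} (hX : Convex ℝ X) (hf : Differentiable ℝ f)
    (hL : ∀ x ∈ X, ∀ y ∈ X, linfNorm (gradient f x - gradient f y) ≤ L * l1Norm (x - y))
    {a p : Vec d} (ha : a ∈ X) (hp : p ∈ X) :
    f p ≤ f a + inner ℝ (gradient f a) (p - a) + L / 2 * l1Norm (p - a) ^ 2 := by
  have hline : ∀ s : ℝ, HasDerivAt (fun s : ℝ => a + s • (p - a)) (p - a) s := fun s => by
    simpa using ((hasDerivAt_id s).smul_const (p - a)).const_add a
  have hd : ∀ s : ℝ, HasDerivAt (fun s : ℝ => f (a + s • (p - a)))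
      (inner ℝ (gradient f (a + s • (p - a))) (p - a)) s := fun s => by
    have h := (hf (a + s • (p - a))).hasGradientAt.hasFDerivAt.comp_hasDerivAt s (hline s)
    simpa [Function.comp_def] using h
  have h := le_taylor_of_deriv_le (φ := fun s : ℝ => f (a + s • (p - a)))
    (M := L / 2 * l1Norm (p - a) ^ 2) (fun s _ => hd s) (fun s hs => ?_)
  · simpa using h
  · have hmem := hX.add_smul_sub_mem ha hp hs
    have h1 := (le_abs_self _).trans (abs_inner_le_linfNorm_mul_l1Norm
      (gradient f (a + s • (p - a)) - gradient f a) (p - a))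
    have h2 := mul_le_mul_of_nonneg_right (hL _ hmem _ ha) (l1Norm_nonneg (p - a))
    rw [inner_sub_left] at h1
    rw [add_sub_cancel_left, l1Norm_smul, abs_of_nonneg hs.1] at h2
    simp only [zero_smul, add_zero]
    linarith

/-- Here ρ is the ℓ_∞ norm of the multiplier of the ball constraint. The product ψρ is paid for by
the decrease of f, which telescopes over the run. -/
theorem IsBallProj.key_inequality {L ψ η t : ℝ} (hX : Convex ℝ X) (hf : Differentiable ℝ f)
    (hL : ∀ x ∈ X, ∀ y ∈ X, linfNorm (gradient f x - gradient f y) ≤ L * l1Norm (x - y))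
    (hL0 : 0 ≤ L) (hψ : 0 < ψ) (hη : 0 < η) (ht : 0 < t) {a p g : Vec d} (ha : a ∈ X)
    (h : IsBallProj X ψ a (a - η • g) p) :
    ∃ ρ : ℝ, 0 ≤ ρ ∧ residual f X p ≤
        ENNReal.ofReal (linfNorm (g - gradient f a) + (L + 1 / η) * ψ + ρ) ∧
      ψ * ρ ≤ f a - f p + t / 2 * linfNorm (g - gradient f a) ^ 2 +
        (L / 2 + 1 / (2 * t)) * ψ ^ 2 := by
  set w : Vec d := η⁻¹ • (p - a) + g with hw
  have hwη : p - (a - η • g) = η • w := by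
    rw [hw, smul_add, smul_inv_smul₀ hη.ne']; abel
  obtain ⟨n, hn, hs⟩ := exists_normal_of_inner_nonneg (w := w) hX hψ ha h.mem h.l1Norm_le
    fun y hy hya => by
      have := h.inner_nonneg y hy hya
      rw [hwη, real_inner_smul_left] at this
      exact nonneg_of_mul_nonneg_right this hη
  set e : Vec d := g - gradient f a with he
  have hpaψ := h.l1Norm_le
  refine ⟨linfNorm (w + n), linfNorm_nonneg _, ?_, ?_⟩
  · refine (residual_le (hf p) h.mem hn).trans (ENNReal.ofReal_le_ofReal ?_)
    have e1 : gradient f p + n = (gradient f p - gradient f a) - e - η⁻¹ • (p - a) + (w + n) := by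
      rw [hw, he]; abel
    have h1 : linfNorm (gradient f p - gradient f a) ≤ L * ψ :=
      (hL _ h.mem _ ha).trans (by gcongr)
    have h2 : linfNorm (η⁻¹ • (p - a)) ≤ 1 / η * ψ := by
      rw [linfNorm_smul, abs_of_nonneg (by positivity), one_div]
      gcongr
      exact (linfNorm_le_l1Norm _).trans hpaψ
    rw [e1]
    have h3 := linfNorm_add_le (gradient f p - gradient f a - e - η⁻¹ • (p - a)) (w + n)
    have h4 := linfNorm_sub_le (gradient f p - gradient f a - e) (η⁻¹ • (p - a))
    have h5 := linfNorm_sub_le (gradient f p - gradient f a) e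
    linarith
  -- Since a ∈ X, the normal n enters with a favorable sign; so does the part (p - a)/η of w. Both
  -- are dropped.
  · have hna : - inner ℝ n (p - a) ≤ 0 := by
      rw [← inner_neg_right, neg_sub]; exact hn a ha
    have hwa : - inner ℝ w (p - a) ≤ - inner ℝ (gradient f a) (p - a) - inner ℝ e (p - a) := by
      have : 0 ≤ η⁻¹ * inner ℝ (p - a) (p - a) := mul_nonneg (by positivity) real_inner_self_nonneg
      rw [hw, he, inner_add_left, inner_sub_left, real_inner_smul_left]
      linarith
    have hdesc := le_add_inner_gradient hX hf hL ha h.mem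
    have hsq : L / 2 * l1Norm (p - a) ^ 2 ≤ L / 2 * ψ ^ 2 := by
      have := l1Norm_nonneg (p - a)
      gcongr
    have hep : - inner ℝ e (p - a) ≤ t / 2 * linfNorm e ^ 2 + 1 / (2 * t) * ψ ^ 2 := by
      have h1 : - inner ℝ e (p - a) ≤ linfNorm e * ψ :=
        ((neg_le_abs _).trans (abs_inner_le_linfNorm_mul_l1Norm _ _)).trans
          (mul_le_mul_of_nonneg_left hpaψ (linfNorm_nonneg e))
      have h2 : t / 2 * linfNorm e ^ 2 + 1 / (2 * t) * ψ ^ 2 - linfNorm e * ψ =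
          (t * linfNorm e - ψ) ^ 2 / (2 * t) := by
        field_simp; ring
      have h3 : 0 ≤ (t * linfNorm e - ψ) ^ 2 / (2 * t) := by positivity
      linarith
    rw [inner_add_left] at hs
    linarith

end OneStep

/-! ### Jensen's inequality and centering in the ℓ_∞ norm -/

section Moments

variable {d : ℕ} {Ξ : Type*} [MeasurableSpace Ξ] {P : Measure Ξ}

theorem linfNorm_integral_le {Z : Ξ → Vec d} (hZ : Integrable Z P) :
    linfNorm (∫ z, Z z ∂P) ≤ ∫ z, linfNorm (Z z) ∂P := by
  have h := (EuclideanSpace.equiv (Fin d) ℝ).toContinuousLinearMap.integral_comp_comm hZ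
  calc linfNorm (∫ z, Z z ∂P) = ‖∫ z, EuclideanSpace.equiv (Fin d) ℝ (Z z) ∂P‖ :=
        (congrArg norm h).symm
    _ ≤ _ := norm_integral_le_integral_norm _

theorem integrable_linfNorm {Z : Ξ → Vec d} (hZ : Integrable Z P) :
    Integrable (fun z => linfNorm (Z z)) P :=
  ((EuclideanSpace.equiv (Fin d) ℝ).toContinuousLinearMap.integrable_comp hZ).norm

theorem sq_integral_le [IsProbabilityMeasure P] {h : Ξ → ℝ} (h1 : Integrable h P)
    (h2 : Integrable (fun z => h z ^ 2) P) : (∫ z, h z ∂P) ^ 2 ≤ ∫ z, h z ^ 2 ∂P := by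
  set c := ∫ z, h z ∂P with hc
  have h0 : 0 ≤ ∫ z, (h z - c) ^ 2 ∂P := integral_nonneg fun z => sq_nonneg _
  have e : ∀ z, (h z - c) ^ 2 = h z ^ 2 - 2 * c * h z + c ^ 2 := fun z => by ring
  have hi : Integrable (fun z => h z ^ 2 - 2 * c * h z) P := h2.sub (h1.const_mul _)
  simp only [e] at h0
  rw [integral_add hi (integrable_const _),
    integral_sub h2 (h1.const_mul _), integral_const_mul, ← hc] at h0
  simp at h0
  linarith

theorem sq_linfNorm_integral_le [IsProbabilityMeasure P] {Z : Ξ → Vec d} (hZ : Integrable Z P)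
    (hZ2 : Integrable (fun z => linfNorm (Z z) ^ 2) P) :
    linfNorm (∫ z, Z z ∂P) ^ 2 ≤ ∫ z, linfNorm (Z z) ^ 2 ∂P :=
  (pow_le_pow_left₀ (linfNorm_nonneg _) (linfNorm_integral_le hZ) 2).trans
    (sq_integral_le (integrable_linfNorm hZ) hZ2)

theorem sq_linfNorm_sub_le (x y : Vec d) :
    linfNorm (x - y) ^ 2 ≤ 2 * linfNorm x ^ 2 + 2 * linfNorm y ^ 2 := by
  have h := pow_le_pow_left₀ (linfNorm_nonneg _) (linfNorm_sub_le x y) 2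
  nlinarith [sq_nonneg (linfNorm x - linfNorm y)]

/-- Centering costs at most a factor `4` in the second moment. -/
theorem integral_sq_linfNorm_centered_le [IsProbabilityMeasure P] {Z : Ξ → Vec d}
    (hZ : Integrable Z P) (hZ2 : Integrable (fun z => linfNorm (Z z) ^ 2) P) :
    Integrable (fun z => linfNorm (Z z - ∫ z, Z z ∂P) ^ 2) P ∧
      ∫ z, linfNorm (Z z - ∫ z, Z z ∂P) ^ 2 ∂P ≤ 4 * ∫ z, linfNorm (Z z) ^ 2 ∂P := by
  have hb := fun z => sq_linfNorm_sub_le (Z z) (∫ z, Z z ∂P)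
  have hi : Integrable
      (fun z => 2 * linfNorm (Z z) ^ 2 + 2 * linfNorm (∫ z, Z z ∂P) ^ 2) P :=
    (hZ2.const_mul 2).add (integrable_const _)
  have hint : Integrable (fun z => linfNorm (Z z - ∫ z, Z z ∂P) ^ 2) P := by
    refine hi.mono' ?_ (Eventually.of_forall fun z => ?_)
    · exact ((continuous_linfNorm.pow 2).comp_aestronglyMeasurable
        (hZ.1.sub aestronglyMeasurable_const))
    · rw [Real.norm_eq_abs, abs_of_nonneg (sq_nonneg _)]
      exact hb z
  refine ⟨hint, (integral_mono hint hi hb).trans ?_⟩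
  rw [integral_add (hZ2.const_mul 2) (integrable_const _), integral_const_mul]
  have := sq_linfNorm_integral_le hZ hZ2
  simp
  linarith

end Moments

/-! ### Second moments of martingales in the ℓ_∞ norm -/

section Martingale

variable {d : ℕ} {Ξ : Type*} [MeasurableSpace Ξ] {P : Measure Ξ}

/-- The squared `ℓ_p` norm on `ℝ^d`, `p = 2 n + 2`. -/
def lpNormSq (n : ℕ) (x : Vec d) : ℝ := powerNormSq n 0 (WithLp.ofLp x)

/-- The constant of the second-moment inequality for martingales in the `ℓ_∞`-norm that
`lpNormSq n` gives. -/
def smoothConst (d n : ℕ) : ℝ := (2 * n + 1) * (d : ℝ) ^ (1 / ((n : ℝ) + 1))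

theorem smoothConst_nonneg (d n : ℕ) : 0 ≤ smoothConst d n := by
  unfold smoothConst; positivity

theorem lpNormSq_nonneg (n : ℕ) (x : Vec d) : 0 ≤ lpNormSq n x := powerNormSq_nonneg n le_rfl _

theorem continuous_lpNormSq (n : ℕ) : Continuous (lpNormSq n : Vec d → ℝ) :=
  (continuous_powerNormSq n 0).comp (PiLp.continuous_ofLp 2 _)

theorem sq_linfNorm_le_lpNormSq (n : ℕ) (x : Vec d) : linfNorm x ^ 2 ≤ lpNormSq n x :=
  sq_norm_le_powerNormSq n _

@[simp] theorem lpNormSq_zero (n : ℕ) : lpNormSq n (0 : Vec d) = 0 := by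
  refine le_antisymm ((powerNormSq_le n _).trans ?_) (lpNormSq_nonneg n _)
  simp

/-- One martingale step. The linear term of the smoothness inequality has mean zero, so the limit ε
→ 0 needs no control of its ε-dependent coefficients. -/
theorem lintegral_lpNormSq_add_le {n : ℕ} (hn : 1 ≤ n) [IsProbabilityMeasure P] {V : ℝ}
    {h : Ξ → Vec d} (hh : Integrable h P) (h0 : ∫ z, h z ∂P = 0)
    (h2 : Integrable (fun z => linfNorm (h z) ^ 2) P) (hV : ∫ z, linfNorm (h z) ^ 2 ∂P ≤ V)
    (x : Vec d) :
    ∫⁻ z, ENNReal.ofReal (lpNormSq n (x + h z)) ∂P ≤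
      ENNReal.ofReal (lpNormSq n x) + ENNReal.ofReal (smoothConst d n * V) := by
  have hV0 : 0 ≤ V := (integral_nonneg fun z => sq_nonneg _).trans hV
  rw [← ENNReal.ofReal_add (lpNormSq_nonneg n x) (mul_nonneg (smoothConst_nonneg d n) hV0)]
  have ht : Tendsto (fun ε => ENNReal.ofReal (powerNormSq n ε (WithLp.ofLp x) +
      smoothConst d n * V)) (𝓝[>] 0) (𝓝 (ENNReal.ofReal (lpNormSq n x + smoothConst d n * V))) :=
    (ENNReal.continuous_ofReal.tendsto _).comp ((tendsto_powerNormSq n _).add_const _)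
  refine ge_of_tendsto ht (eventually_mem_nhdsWithin.mono fun ε hε => ?_)
  obtain ⟨g, hg⟩ := exists_powerNormSq_add_le hn hε (WithLp.ofLp x)
  have hcoord : ∀ i, Integrable (fun z => h z i) P := fun i =>
    (EuclideanSpace.proj i : Vec d →L[ℝ] ℝ).integrable_comp hh
  have hlin : Integrable (fun z => ∑ i, g i * h z i) P :=
    integrable_finsetSum _ fun i _ => (hcoord i).const_mul _
  have hlin0 : ∫ z, ∑ i, g i * h z i ∂P = 0 := by
    rw [integral_finsetSum _ fun i _ => (hcoord i).const_mul _]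
    refine Finset.sum_eq_zero fun i _ => ?_
    have : ∫ z, h z i ∂P = (∫ z, h z ∂P) i :=
      (EuclideanSpace.proj i : Vec d →L[ℝ] ℝ).integral_comp_comm hh
    rw [integral_const_mul, this, h0]
    simp
  set r : Ξ → ℝ := fun z => powerNormSq n ε (WithLp.ofLp x) + ∑ i, g i * h z i +
    smoothConst d n * linfNorm (h z) ^ 2 with hr
  have hai : Integrable (fun z => powerNormSq n ε (WithLp.ofLp x) + ∑ i, g i * h z i) P :=
    (integrable_const _).add hlin
  have hri : Integrable r P := hai.add (h2.const_mul _)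
  have hle : ∀ z, lpNormSq n (x + h z) ≤ r z := fun z => by
    have h3 : (2 * n + 1) * powerNormSq n 0 (WithLp.ofLp (h z)) ≤
        smoothConst d n * linfNorm (h z) ^ 2 := by
      have := powerNormSq_le n (WithLp.ofLp (h z))
      rw [Fintype.card_fin] at this
      rw [smoothConst, mul_assoc]
      exact mul_le_mul_of_nonneg_left this (by positivity)
    calc lpNormSq n (x + h z) ≤ powerNormSq n ε (WithLp.ofLp (x + h z)) :=
          powerNormSq_mono n (le_of_lt hε) _
      _ ≤ _ := hg (WithLp.ofLp (h z))
      _ ≤ _ := by simp only [hr]; gcongr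
  calc ∫⁻ z, ENNReal.ofReal (lpNormSq n (x + h z)) ∂P ≤ ∫⁻ z, ENNReal.ofReal (r z) ∂P :=
        lintegral_mono fun z => ENNReal.ofReal_le_ofReal (hle z)
    _ = ENNReal.ofReal (∫ z, r z ∂P) := (ofReal_integral_eq_lintegral_ofReal hri
        (Eventually.of_forall fun z => (lpNormSq_nonneg n _).trans (hle z))).symm
    _ ≤ _ := by
        refine ENNReal.ofReal_le_ofReal ?_
        simp only [hr]
        rw [integral_add hai (h2.const_mul _),
          integral_add (integrable_const _) hlin, hlin0, integral_const_mul]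
        simp only [integral_const, probReal_univ, one_smul, add_zero]
        gcongr
        exact smoothConst_nonneg d n

/-- The properties of the increments of a martingale: measurable and centered, with second moment
at most `V`. -/
structure IsIncrement {𝒰 : Type*} [MeasurableSpace 𝒰] (P : Measure Ξ) (V : ℝ)
    (H : 𝒰 → Ξ → Vec d) : Prop where
  measurable : Measurable (Function.uncurry H)
  integrable : ∀ u, Integrable (H u) P
  integral_eq_zero : ∀ u, ∫ z, H u z ∂P = 0
  integrable_sq : ∀ u, Integrable (fun z => linfNorm (H u z) ^ 2) P
  integral_sq_le : ∀ u, ∫ z, linfNorm (H u z) ^ 2 ∂P ≤ V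

variable {Ω : Type*} [MeasurableSpace Ω] {μ : Measure Ω} {𝒰 : Type*} [MeasurableSpace 𝒰]

/-- By independence and Tonelli, Z is integrated out with (S, U) frozen. The Lebesgue integral in
[0, ∞] dispenses with integrability of S. -/
theorem IsIncrement.lintegral_add_le {n : ℕ} (hn : 1 ≤ n) [IsProbabilityMeasure P]
    [IsProbabilityMeasure μ] {V : ℝ} {H : 𝒰 → Ξ → Vec d} (hH : IsIncrement P V H)
    {S : Ω → Vec d} {U : Ω → 𝒰} {Z : Ω → Ξ}
    (hS : Measurable S) (hU : Measurable U) (hZ : Measurable Z) (hlaw : μ.map Z = P)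
    (hind : IndepFun (fun ω => (S ω, U ω)) Z μ) :
    ∫⁻ ω, ENNReal.ofReal (lpNormSq n (S ω + H (U ω) (Z ω))) ∂μ ≤
      ∫⁻ ω, ENNReal.ofReal (lpNormSq n (S ω)) ∂μ + ENNReal.ofReal (smoothConst d n * V) := by
  have hW : Measurable fun ω => (S ω, U ω) := hS.prodMk hU
  set ν := μ.map fun ω => (S ω, U ω)
  have : IsProbabilityMeasure ν := Measure.isProbabilityMeasure_map hW.aemeasurable
  have hmap : μ.map (fun ω => ((S ω, U ω), Z ω)) = ν.prod P := by
    rw [(indepFun_iff_map_prod_eq_prod_map_map hW.aemeasurable hZ.aemeasurable).1 hind, hlaw]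
  have hN : Measurable (lpNormSq n : Vec d → ℝ) := (continuous_lpNormSq n).measurable
  have hmeas : Measurable fun p : (Vec d × 𝒰) × Ξ =>
      ENNReal.ofReal (lpNormSq n (p.1.1 + H p.1.2 p.2)) := by
    have h1 : Measurable fun p : (Vec d × 𝒰) × Ξ => H p.1.2 p.2 :=
      hH.measurable.comp ((measurable_snd.comp measurable_fst).prodMk measurable_snd)
    exact (hN.comp ((measurable_fst.comp measurable_fst).add h1)).ennreal_ofReal
  have hmeas' : Measurable fun w : Vec d × 𝒰 => ENNReal.ofReal (lpNormSq n w.1) :=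
    (hN.comp measurable_fst).ennreal_ofReal
  calc ∫⁻ ω, ENNReal.ofReal (lpNormSq n (S ω + H (U ω) (Z ω))) ∂μ
      = ∫⁻ p, ENNReal.ofReal (lpNormSq n (p.1.1 + H p.1.2 p.2))
          ∂(μ.map fun ω => ((S ω, U ω), Z ω)) := (lintegral_map hmeas (hW.prodMk hZ)).symm
    _ = ∫⁻ w, ∫⁻ z, ENNReal.ofReal (lpNormSq n (w.1 + H w.2 z)) ∂P ∂ν := by
        rw [hmap, lintegral_prod _ hmeas.aemeasurable]
    _ ≤ ∫⁻ w, (ENNReal.ofReal (lpNormSq n w.1) + ENNReal.ofReal (smoothConst d n * V)) ∂ν :=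
        lintegral_mono fun w => lintegral_lpNormSq_add_le hn (hH.integrable _)
          (hH.integral_eq_zero _) (hH.integrable_sq _) (hH.integral_sq_le _) _
    _ = _ := by
        rw [lintegral_add_left hmeas', lintegral_map hmeas' hW]
        simp

theorem IsIncrement.lintegral_add_sum_le {n : ℕ} (hn : 1 ≤ n) [IsProbabilityMeasure P]
    [IsProbabilityMeasure μ] {V : ℝ} (hV : 0 ≤ V) {H : 𝒰 → Ξ → Vec d} (hH : IsIncrement P V H)
    {S : Ω → Vec d} {U : Ω → 𝒰} {Z : ℕ → Ω → Ξ}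
    (hS : Measurable S) (hU : Measurable U) (hZ : ∀ i, Measurable (Z i))
    (hlaw : ∀ i, μ.map (Z i) = P)
    (hind : ∀ j, IndepFun (fun ω => (S ω + ∑ i ∈ Finset.range j, H (U ω) (Z i ω), U ω)) (Z j) μ)
    (j : ℕ) :
    ∫⁻ ω, ENNReal.ofReal (lpNormSq n (S ω + ∑ i ∈ Finset.range j, H (U ω) (Z i ω))) ∂μ ≤
      ∫⁻ ω, ENNReal.ofReal (lpNormSq n (S ω)) ∂μ +
        ENNReal.ofReal (j * (smoothConst d n * V)) := by
  have hC := mul_nonneg (smoothConst_nonneg d n) hV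
  induction j with
  | zero => simp
  | succ j ih =>
    have hSj : Measurable fun ω => S ω + ∑ i ∈ Finset.range j, H (U ω) (Z i ω) :=
      hS.add (Finset.measurable_fun_sum _ fun i _ => hH.measurable.comp (hU.prodMk (hZ i)))
    have h := hH.lintegral_add_le (n := n) hn hSj hU (hZ j) (hlaw j) (hind j)
    simp only [Finset.sum_range_succ, ← add_assoc]
    refine h.trans ((add_le_add_left ih _).trans ?_)
    rw [add_assoc, ← ENNReal.ofReal_add (by positivity) hC]
    gcongr
    push_cast
    linarith

end Martingale

/-! ### Independence of a fresh sample from the past -/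

section Past

variable {Ω 𝒳 Ξ : Type*} [MeasurableSpace 𝒳] [MeasurableSpace Ξ]

/-- The σ-algebra generated by the initial point and by the samples with index in `T`. -/
@[reducible] def past (x₁ : Ω → 𝒳) (ζ : ℕ → ℕ → Ω → Ξ) (T : Set (ℕ × ℕ)) : MeasurableSpace Ω :=
  MeasurableSpace.comap x₁ inferInstance ⊔
    ⨆ p ∈ T, MeasurableSpace.comap (ζ p.1 p.2) inferInstance

variable {x₁ : Ω → 𝒳} {ζ : ℕ → ℕ → Ω → Ξ}

theorem past_mono {S T : Set (ℕ × ℕ)} (h : S ⊆ T) : past x₁ ζ S ≤ past x₁ ζ T :=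
  sup_le_sup_left (biSup_mono fun _ hp => h hp) _

theorem measurable_past_init (T : Set (ℕ × ℕ)) : Measurable[past x₁ ζ T] x₁ :=
  measurable_iff_comap_le.2 le_sup_left

theorem measurable_past_sample {T : Set (ℕ × ℕ)} {k i : ℕ} (h : (k, i) ∈ T) :
    Measurable[past x₁ ζ T] (ζ k i) :=
  measurable_iff_comap_le.2 (le_sup_of_le_right
    (le_biSup (fun p : ℕ × ℕ => MeasurableSpace.comap (ζ p.1 p.2) inferInstance) h))

theorem past_le_of_measurable {T : Set (ℕ × ℕ)} {m : MeasurableSpace Ω} (hx : Measurable[m] x₁)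
    (hζ : ∀ p ∈ T, Measurable[m] (ζ p.1 p.2)) : past x₁ ζ T ≤ m :=
  sup_le hx.comap_le (iSup₂_le fun p hp => (hζ p hp).comap_le)

variable [MeasurableSpace Ω] {μ : Measure Ω}

theorem indepFun_prodMk_left_of_prodMk_right [IsProbabilityMeasure μ] {𝒴 𝒵 : Type*}
    [MeasurableSpace 𝒴] [MeasurableSpace 𝒵] {A : Ω → 𝒳} {B : Ω → 𝒴} {C : Ω → 𝒵}
    (hA : Measurable A) (hB : Measurable B) (hC : Measurable C)
    (hABC : IndepFun A (fun ω => (B ω, C ω)) μ) (hBC : IndepFun B C μ) :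
    IndepFun (fun ω => (A ω, B ω)) C μ := by
  have hAB : IndepFun A B μ := hABC.comp measurable_id measurable_fst
  have : IsProbabilityMeasure (μ.map A) := Measure.isProbabilityMeasure_map hA.aemeasurable
  have : IsProbabilityMeasure (μ.map B) := Measure.isProbabilityMeasure_map hB.aemeasurable
  have : IsProbabilityMeasure (μ.map C) := Measure.isProbabilityMeasure_map hC.aemeasurable
  rw [indepFun_iff_map_prod_eq_prod_map_map (hA.prodMk hB).aemeasurable hC.aemeasurable,
    (indepFun_iff_map_prod_eq_prod_map_map hA.aemeasurable hB.aemeasurable).1 hAB,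
    ← (measurePreserving_prodAssoc (μ.map A) (μ.map B) (μ.map C)).symm.map_eq,
    ← (indepFun_iff_map_prod_eq_prod_map_map hB.aemeasurable hC.aemeasurable).1 hBC,
    ← (indepFun_iff_map_prod_eq_prod_map_map hA.aemeasurable (hB.prodMk hC).aemeasurable).1 hABC,
    Measure.map_map (MeasurableEquiv.measurable _) (hA.prodMk (hB.prodMk hC))]
  rfl

/-- Disjoint blocks of independent samples are independent, and
`indepFun_prodMk_left_of_prodMk_right` adjoins the initial point to the block T. -/
theorem indepFun_of_measurable_past [IsProbabilityMeasure μ] (hx : Measurable x₁)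
    (hζ : ∀ k i, Measurable (ζ k i)) (hind : iIndepFun (fun p : ℕ × ℕ => ζ p.1 p.2) μ)
    (hx₁ : IndepFun x₁ (fun ω (p : ℕ × ℕ) => ζ p.1 p.2 ω) μ) {T : Set (ℕ × ℕ)} {k i : ℕ}
    (hT : (k, i) ∉ T) {𝒲 : Type*} [MeasurableSpace 𝒲] {W : Ω → 𝒲}
    (hW : Measurable[past x₁ ζ T] W) : IndepFun W (ζ k i) μ := by
  have hZT : Measurable fun ω (p : T) => ζ p.1.1 p.1.2 ω := measurable_pi_lambda _ fun p => hζ _ _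
  have hBC : IndepFun (fun ω (p : T) => ζ p.1.1 p.1.2 ω) (ζ k i) μ := by
    have h := indep_iSup_of_disjoint (fun p : ℕ × ℕ => (hζ p.1 p.2).comap_le) hind.iIndep
      (S := T) (T := {(k, i)}) (Set.disjoint_singleton_right.2 hT)
    rw [IndepFun_iff_Indep]
    refine indep_of_indep_of_le_left (indep_of_indep_of_le_right h ?_) ?_
    · exact le_biSup (fun p : ℕ × ℕ => MeasurableSpace.comap (ζ p.1 p.2) inferInstance)
        (Set.mem_singleton (k, i))
    · rw [MeasurableSpace.pi, MeasurableSpace.comap_iSup]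
      refine iSup_le fun p => ?_
      rw [MeasurableSpace.comap_comp]
      exact le_biSup (fun p : ℕ × ℕ => MeasurableSpace.comap (ζ p.1 p.2) inferInstance) p.2
  have hABC : IndepFun x₁ (fun ω => ((fun p : T => ζ p.1.1 p.1.2 ω), ζ k i ω)) μ :=
    hx₁.comp (φ := id) (ψ := fun z : ℕ × ℕ → Ξ => ((fun p : T => z p.1), z (k, i)))
      measurable_id (by fun_prop)
  have h := indepFun_prodMk_left_of_prodMk_right hx hZT (hζ k i) hABC hBC
  rw [IndepFun_iff_Indep] at h ⊢
  refine indep_of_indep_of_le_left h (hW.comap_le.trans ?_)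
  refine past_le_of_measurable ?_ fun p hp => ?_
  · exact measurable_fst.comp (comap_measurable _)
  · have hm : Measurable fun w : 𝒳 × (T → Ξ) => w.2 ⟨p, hp⟩ := by fun_prop
    exact hm.comp (comap_measurable _)

end Past

/-! ### Gradient noise as martingale increments -/

theorem measurable_gradient {d : ℕ} (f : Vec d → ℝ) : Measurable (gradient f) :=
  (InnerProductSpace.toDual ℝ (Vec d)).symm.continuous.measurable.comp (measurable_fderiv ℝ f)

section Oracle

variable {d : ℕ} {Ξ : Type*} [MeasurableSpace Ξ] {P : Measure Ξ} {X : Set (Vec d)}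
  {F : Vec d → Ξ → ℝ}

theorem IsProblem.measurable_stochGrad (hF : IsProblem X F P) {α : Type*} {mα : MeasurableSpace α}
    {a : α → Vec d} {z : α → Ξ} (ha : Measurable a) (haX : ∀ w, a w ∈ X) (hz : Measurable z) :
    Measurable fun w => stochGrad F (a w) (z w) :=
  hF.measurable_oracle.comp ((ha.subtype_mk (h := haX)).prodMk hz)

theorem IsProblem.measurable_sum_stochGrad (hF : IsProblem X F P) {α : Type*}
    {mα : MeasurableSpace α} {a : α → Vec d} {z : ℕ → α → Ξ} (ha : Measurable a)
    (haX : ∀ w, a w ∈ X) (hz : ∀ i, Measurable (z i)) (j : ℕ) :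
    Measurable fun w => ∑ i ∈ Finset.range j, stochGrad F (a w) (z i w) :=
  Finset.measurable_fun_sum _ fun i _ => hF.measurable_stochGrad ha haX (hz i)

theorem IsProblem.integral_stochGrad_sub (hF : IsProblem X F P) {x y : Vec d} (hx : x ∈ X)
    (hy : y ∈ X) : ∫ z, (stochGrad F x z - stochGrad F y z) ∂P =
      gradient (objective F P) x - gradient (objective F P) y := by
  rw [integral_sub (hF.integrable_oracle x hx) (hF.integrable_oracle y hy), hF.unbiased x hx,
    hF.unbiased y hy]

/-- Unbiasedness writes the difference as a mean, so Jensen's inequality transfers mean-squared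
smoothness to f with the same L. -/
theorem linfNorm_gradient_sub_le [IsProbabilityMeasure P] (hF : IsProblem X F P) {L : ℝ}
    (hL : 0 ≤ L) (hLip : MeanSquaredSmooth X F P L) {x y : Vec d} (hx : x ∈ X) (hy : y ∈ X) :
    linfNorm (gradient (objective F P) x - gradient (objective F P) y) ≤ L * l1Norm (x - y) := by
  have h := sq_linfNorm_integral_le
    ((hF.integrable_oracle x hx).sub (hF.integrable_oracle y hy)) (hLip x hx y hy).1
  simp only [Pi.sub_apply] at h
  rw [hF.integral_stochGrad_sub hx hy] at h
  refine (pow_le_pow_iff_left₀ (linfNorm_nonneg _) (mul_nonneg hL (l1Norm_nonneg _))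
    two_ne_zero).1 ?_
  rw [mul_pow]
  exact h.trans (hLip x hx y hy).2

theorem isIncrement_smul_centered [IsProbabilityMeasure P] (hF : IsProblem X F P) {σ : ℝ}
    (hσ : BoundedVariance X F P σ) (r : ℝ) :
    IsIncrement P (r ^ 2 * σ ^ 2) fun (a : X) z =>
      r • (stochGrad F a z - gradient (objective F P) a) := by
  have e : ∀ (a : X) z, linfNorm (r • (stochGrad F a z - gradient (objective F P) a)) ^ 2 =
      r ^ 2 * linfNorm (stochGrad F a z - gradient (objective F P) a) ^ 2 := fun a z => by
    rw [linfNorm_smul, mul_pow, sq_abs]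
  refine ⟨?_, fun a => ?_, fun a => ?_, fun a => ?_, fun a => ?_⟩
  · refine Measurable.const_smul (Measurable.sub ?_ ?_) r
    · exact hF.measurable_oracle
    · exact (measurable_gradient _).comp (measurable_subtype_coe.comp measurable_fst)
  · exact ((hF.integrable_oracle a a.2).sub (integrable_const _)).smul r
  · rw [integral_smul, integral_sub (hF.integrable_oracle a a.2) (integrable_const _),
      hF.unbiased a a.2]
    simp
  · simp only [e]
    exact (hσ a a.2).1.const_mul _
  · simp only [e]
    rw [integral_const_mul]
    exact mul_le_mul_of_nonneg_left (hσ a a.2).2 (sq_nonneg r)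

/-- Restricting to pairs at ℓ₁ distance at most ψ, as consecutive iterates are, makes the bound
uniform. The factor 4 is the price of centering. -/
theorem isIncrement_smul_centered_sub [IsProbabilityMeasure P] (hF : IsProblem X F P) {L ψ : ℝ}
    (hLip : MeanSquaredSmooth X F P L) (r : ℝ) :
    IsIncrement P (r ^ 2 * (4 * (L ^ 2 * ψ ^ 2)))
      fun (u : {u : X × X // l1Norm ((u.1 : Vec d) - (u.2 : Vec d)) ≤ ψ}) z =>
        r • (stochGrad F u.1.1 z - stochGrad F u.1.2 z -
          (gradient (objective F P) u.1.1 - gradient (objective F P) u.1.2)) := by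
  have e : ∀ (u : {u : X × X // l1Norm ((u.1 : Vec d) - (u.2 : Vec d)) ≤ ψ}) z,
      linfNorm (r • (stochGrad F u.1.1 z - stochGrad F u.1.2 z -
          (gradient (objective F P) u.1.1 - gradient (objective F P) u.1.2))) ^ 2 =
      r ^ 2 * linfNorm (stochGrad F u.1.1 z - stochGrad F u.1.2 z -
          (gradient (objective F P) u.1.1 - gradient (objective F P) u.1.2)) ^ 2 := fun u z => by
    rw [linfNorm_smul, mul_pow, sq_abs]
  have hi : ∀ u : {u : X × X // l1Norm ((u.1 : Vec d) - (u.2 : Vec d)) ≤ ψ},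
      Integrable (fun z => stochGrad F u.1.1 z - stochGrad F u.1.2 z) P := fun u =>
    (hF.integrable_oracle _ u.1.1.2).sub (hF.integrable_oracle _ u.1.2.2)
  have hc := fun u : {u : X × X // l1Norm ((u.1 : Vec d) - (u.2 : Vec d)) ≤ ψ} =>
    integral_sq_linfNorm_centered_le (hi u) (hLip _ u.1.1.2 _ u.1.2.2).1
  simp only [hF.integral_stochGrad_sub (Subtype.prop _) (Subtype.prop _)] at hc
  refine ⟨?_, fun u => ?_, fun u => ?_, fun u => ?_, fun u => ?_⟩
  · have h1 : Measurable fun w : {u : X × X // l1Norm ((u.1 : Vec d) - (u.2 : Vec d)) ≤ ψ} × Ξ =>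
        w.1.1.1 := measurable_fst.comp (measurable_subtype_coe.comp measurable_fst)
    have h2 : Measurable fun w : {u : X × X // l1Norm ((u.1 : Vec d) - (u.2 : Vec d)) ≤ ψ} × Ξ =>
        w.1.1.2 := measurable_snd.comp (measurable_subtype_coe.comp measurable_fst)
    refine Measurable.const_smul (Measurable.sub (Measurable.sub ?_ ?_) (Measurable.sub ?_ ?_)) r
    · exact hF.measurable_oracle.comp (h1.prodMk measurable_snd)
    · exact hF.measurable_oracle.comp (h2.prodMk measurable_snd)
    · exact (measurable_gradient _).comp (measurable_subtype_coe.comp h1)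
    · exact (measurable_gradient _).comp (measurable_subtype_coe.comp h2)
  · exact ((hi u).sub (integrable_const _)).smul r
  · rw [integral_smul, integral_sub (hi u) (integrable_const _),
      hF.integral_stochGrad_sub u.1.1.2 u.1.2.2]
    simp
  · simp only [e]
    exact (hc u).1.const_mul _
  · simp only [e]
    rw [integral_const_mul]
    refine mul_le_mul_of_nonneg_left ((hc u).2.trans ?_) (sq_nonneg r)
    refine mul_le_mul_of_nonneg_left ((hLip _ u.1.1.2 _ u.1.2.2).2.trans ?_) (by norm_num)
    have := l1Norm_nonneg ((u.1.1 : Vec d) - (u.1.2 : Vec d))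
    have := u.2
    gcongr

end Oracle

/-! ### Position within an epoch -/

theorem eq_epochStart_iff {q k : ℕ} (hk : 1 ≤ k) : k = epochStart q k ↔ (k - 1) % q = 0 := by
  have h := Nat.div_add_mod' (k - 1) q
  unfold epochStart
  omega

theorem add_one_mod_of_ne_zero {q a : ℕ} (hq : 1 ≤ q) (h : (a + 1) % q ≠ 0) :
    (a + 1) % q = a % q + 1 := by
  have hlt := Nat.mod_lt a hq
  rcases Nat.lt_or_ge (a % q + 1) q with h1 | h1
  · rw [Nat.add_mod, Nat.mod_eq_of_lt (b := q) (a := a % q + 1 % q)]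
    · rw [Nat.mod_eq_of_lt (a := 1) (by omega)]
    · rw [Nat.mod_eq_of_lt (a := 1) (by omega)]; exact h1
  · exfalso
    refine h ?_
    have := Nat.div_add_mod' a q
    have e : a + 1 = (a / q + 1) * q := by rw [add_mul]; omega
    rw [e, Nat.mul_mod_left]

/-! ### The estimation error along a run -/

section Run

variable {d : ℕ} {Ξ Ω : Type*} [MeasurableSpace Ξ] [MeasurableSpace Ω] {P : Measure Ξ}
  {μ : Measure Ω} {X : Set (Vec d)} {F : Vec d → Ξ → ℝ} {ψ η : ℝ} {K q m m₁ : ℕ}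
  {x G : ℕ → Ω → Vec d} {ζ : ℕ → ℕ → Ω → Ξ} {Y : Ω → ℕ}

theorem IsSpiderRun.mem {φ : Vec d → EReal} (hrun : IsSpiderRun X F P φ η K q m m₁ μ x G ζ Y)
    {k : ℕ} (hk : 1 ≤ k) (hkK : k ≤ K + 1) (ω : Ω) : x k ω ∈ X := by
  obtain rfl | hk := hk.eq_or_lt
  · exact hrun.init_mem ω
  · obtain ⟨k, rfl⟩ : ∃ j, k = j + 1 := ⟨k - 1, by omega⟩
    exact (hrun.step k (by omega) (by omega) ω).1

theorem IsSpiderRun.isBallProj (hX : Convex ℝ X) (hψ : 0 ≤ ψ)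
    (hrun : IsSpiderRun X F P (indicatorFn (l1Ball d ψ)) η K q m m₁ μ x G ζ Y)
    {k : ℕ} (hk : 1 ≤ k) (hkK : k ≤ K) (ω : Ω) :
    IsBallProj X ψ (x k ω) (x k ω - η • G k ω) (x (k + 1) ω) :=
  (hrun.step k hk hkK ω).isBallProj hX hψ (hrun.mem hk (by omega) ω)

theorem IsSpiderRun.measurable_past_estimate_start {φ : Vec d → EReal} (hF : IsProblem X F P)
    (hrun : IsSpiderRun X F P φ η K q m m₁ μ x G ζ Y) {k : ℕ} (hk : 1 ≤ k) (hkK : k ≤ K)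
    (hs : k = epochStart q k) (hx : Measurable[past (x 1) ζ {p | p.1 < k}] (x k)) :
    Measurable[past (x 1) ζ {p | p.1 < k + 1}] (G k) := by
  rw [funext (hrun.estimate_start k hk hkK hs)]
  exact (hF.measurable_sum_stochGrad
    (hx.mono (past_mono fun p (hp : p.1 < k) => Nat.lt_succ_of_lt hp) le_rfl)
    (hrun.mem hk (by omega)) (fun i => measurable_past_sample (Nat.lt_succ_self k)) _).const_smul
      (1 / (batchSize q m m₁ k : ℝ))

/-- The iterate x k depends on samples of iterations before k only, whereas G k also uses those of
iteration k. The two claims need each other, hence the joint induction. -/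
theorem IsSpiderRun.measurable_past (hF : IsProblem X F P) (hψ : 0 < ψ)
    (hrun : IsSpiderRun X F P (indicatorFn (l1Ball d ψ)) η K q m m₁ μ x G ζ Y)
    {k : ℕ} (hk : 1 ≤ k) : k ≤ K + 1 → Measurable[past (x 1) ζ {p | p.1 < k}] (x k) ∧
      (k ≤ K → Measurable[past (x 1) ζ {p | p.1 < k + 1}] (G k)) := by
  induction k, hk using Nat.le_induction with
  | base =>
    refine fun _ => ⟨measurable_past_init _, fun h1 => ?_⟩
    exact hrun.measurable_past_estimate_start hF le_rfl h1 (by simp [epochStart])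
      (measurable_past_init _)
  | succ k hk ih =>
    intro hkK
    obtain ⟨hxk, hGk⟩ := ih (by omega)
    have hGk := hGk (by omega)
    have hxk' : Measurable[past (x 1) ζ {p | p.1 < k + 1}] (x k) :=
      hxk.mono (past_mono fun p (hp : p.1 < k) => Nat.lt_succ_of_lt hp) le_rfl
    have hx : Measurable[past (x 1) ζ {p | p.1 < k + 1}] (x (k + 1)) :=
      measurable_of_isBallProj hF.isClosed hF.convex hψ hxk' (hxk'.sub (hGk.const_smul η))
        (hrun.mem hk (by omega)) fun ω => hrun.isBallProj hF.convex hψ.le hk (by omega) ω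
    refine ⟨hx, fun hkK' => ?_⟩
    by_cases hs : k + 1 = epochStart q (k + 1)
    · exact hrun.measurable_past_estimate_start hF (by omega) hkK' hs hx
    · have hmono : past (x 1) ζ {p | p.1 < k + 1} ≤ past (x 1) ζ {p | p.1 < k + 1 + 1} :=
        past_mono fun p (hp : p.1 < k + 1) => Nat.lt_succ_of_lt hp
      rw [funext (hrun.estimate_inner (k + 1) (by omega) hkK' hs)]
      have hsum := fun a (ha : Measurable[past (x 1) ζ {p | p.1 < k + 1}] a) haX =>
        hF.measurable_sum_stochGrad (ha.mono hmono le_rfl) haX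
          (fun i => measurable_past_sample (i := i) (Nat.lt_succ_self (k + 1)))
          (batchSize q m m₁ (k + 1))
      exact (((hsum _ hx (hrun.mem (by omega) (by omega))).sub
        (hsum _ hxk' (hrun.mem hk (by omega)))).const_smul (1 / (batchSize q m m₁ (k + 1) : ℝ))).add (hGk.mono hmono le_rfl)

theorem IsSpiderRun.past_le {φ : Vec d → EReal} (hrun : IsSpiderRun X F P φ η K q m m₁ μ x G ζ Y)
    (T : Set (ℕ × ℕ)) : past (x 1) ζ T ≤ ‹MeasurableSpace Ω› :=
  past_le_of_measurable hrun.measurable_init fun _ _ => hrun.measurable_sample _ _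

theorem IsSpiderRun.lintegral_batch_le {φ : Vec d → EReal} [IsProbabilityMeasure P]
    [IsProbabilityMeasure μ] (hrun : IsSpiderRun X F P φ η K q m m₁ μ x G ζ Y)
    {𝒰 : Type*} [MeasurableSpace 𝒰] {H : 𝒰 → Ξ → Vec d} {V : ℝ} (hV : 0 ≤ V)
    (hH : IsIncrement P V H) {k : ℕ} {S : Ω → Vec d} {U : Ω → 𝒰}
    (hS : Measurable[past (x 1) ζ {p | p.1 < k}] S)
    (hU : Measurable[past (x 1) ζ {p | p.1 < k}] U) {n : ℕ} (hn : 1 ≤ n) (j : ℕ) :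
    ∫⁻ ω, ENNReal.ofReal (lpNormSq n (S ω + ∑ i ∈ Finset.range j, H (U ω) (ζ k i ω))) ∂μ ≤
      ∫⁻ ω, ENNReal.ofReal (lpNormSq n (S ω)) ∂μ +
        ENNReal.ofReal (j * (smoothConst d n * V)) := by
  refine hH.lintegral_add_sum_le hn hV (hS.mono (hrun.past_le _) le_rfl)
    (hU.mono (hrun.past_le _) le_rfl) (hrun.measurable_sample k) (hrun.law_sample k)
    (fun j => ?_) j
  -- Inside a batch, the past of sample j also contains the samples i < j of the same iteration.
  set T : Set (ℕ × ℕ) := {p | p.1 < k ∨ p.1 = k ∧ p.2 < j} with hT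
  have hmono : past (x 1) ζ {p | p.1 < k} ≤ past (x 1) ζ T := past_mono fun p hp => Or.inl hp
  have hUT := hU.mono hmono le_rfl
  refine indepFun_of_measurable_past hrun.measurable_init hrun.measurable_sample
    hrun.indep_sample hrun.indep_init (T := T) (by simp [hT]) ?_
  refine Measurable.prodMk ((hS.mono hmono le_rfl).add
    (Finset.measurable_fun_sum _ fun i hi => ?_)) hUT
  exact hH.measurable.comp (hUT.prodMk
    (measurable_past_sample (Or.inr ⟨rfl, Finset.mem_range.1 hi⟩)))

/-- The second moment of the SPIDER estimation error. -/
theorem IsSpiderRun.lintegral_lpNormSq_error_le [IsProbabilityMeasure P] [IsProbabilityMeasure μ]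
    (hF : IsProblem X F P) (hψ : 0 < ψ) {σ L : ℝ} (hσ : BoundedVariance X F P σ)
    (hLip : MeanSquaredSmooth X F P L) (hq : 1 ≤ q) (hm : 1 ≤ m) (hm₁ : 1 ≤ m₁)
    (hrun : IsSpiderRun X F P (indicatorFn (l1Ball d ψ)) η K q m m₁ μ x G ζ Y)
    {n : ℕ} (hn : 1 ≤ n) {k : ℕ} (hk : 1 ≤ k) : k ≤ K →
    ∫⁻ ω, ENNReal.ofReal (lpNormSq n (G k ω - gradient (objective F P) (x k ω))) ∂μ ≤
      ENNReal.ofReal (smoothConst d n *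
        (σ ^ 2 / m₁ + ((k - 1) % q : ℕ) * (4 * (L ^ 2 * ψ ^ 2) / m))) := by
  have hC := smoothConst_nonneg d n
  have hm0 : (m : ℝ) ≠ 0 := by positivity
  have hm₁0 : (m₁ : ℝ) ≠ 0 := by positivity
  -- A restart forgets the previous error, so every epoch start is bounded directly: m₁ increments
  -- with second moment at most σ²/m₁² each.
  have hstart : ∀ k, 1 ≤ k → k ≤ K → (k - 1) % q = 0 →
      ∫⁻ ω, ENNReal.ofReal (lpNormSq n (G k ω - gradient (objective F P) (x k ω))) ∂μ ≤
        ENNReal.ofReal (smoothConst d n *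
          (σ ^ 2 / m₁ + ((k - 1) % q : ℕ) * (4 * (L ^ 2 * ψ ^ 2) / m))) := by
    intro k hk hkK hs0
    have hs := (eq_epochStart_iff hk).2 hs0
    have hU : Measurable[past (x 1) ζ {p | p.1 < k}]
        fun ω => (⟨x k ω, hrun.mem hk (by omega) ω⟩ : X) :=
      (hrun.measurable_past hF hψ hk (by omega)).1.subtype_mk
    have h := hrun.lintegral_batch_le (by positivity)
      (isIncrement_smul_centered hF hσ (1 / (m₁ : ℝ))) (S := fun _ => 0) measurable_const hU hn m₁
    simp only [zero_add, lpNormSq_zero, ENNReal.ofReal_zero, lintegral_zero] at h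
    have e : ∀ ω, G k ω - gradient (objective F P) (x k ω) = ∑ i ∈ Finset.range m₁,
        (1 / (m₁ : ℝ)) • (stochGrad F (x k ω) (ζ k i ω) -
          gradient (objective F P) (x k ω)) := fun ω => by
      rw [hrun.estimate_start k hk hkK hs ω, batchSize, if_pos hs, ← Finset.smul_sum,
        Finset.sum_sub_distrib, smul_sub, Finset.sum_const, Finset.card_range,
        ← Nat.cast_smul_eq_nsmul ℝ, smul_smul, one_div_mul_cancel hm₁0, one_smul]
    simp only [e]
    refine h.trans (ENNReal.ofReal_le_ofReal (le_of_eq ?_))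
    rw [hs0]
    push_cast
    field_simp
    ring
  induction k, hk using Nat.le_induction with
  | base => exact fun h1 => hstart 1 le_rfl h1 (by simp)
  | succ k hk ih =>
    intro hkK
    by_cases hs0 : (k + 1 - 1) % q = 0
    · exact hstart (k + 1) (by omega) hkK hs0
    have hs : k + 1 ≠ epochStart q (k + 1) := fun h =>
      hs0 ((eq_epochStart_iff (by omega)).1 h)
    have ih := ih (by omega)
    have hx := hrun.measurable_past hF hψ (k := k + 1) (by omega) (by omega)
    have hxk := hrun.measurable_past hF hψ hk (by omega)
    have hxk' : Measurable[past (x 1) ζ {p | p.1 < k + 1}] (x k) :=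
      hxk.1.mono (past_mono fun p (hp : p.1 < k) => Nat.lt_succ_of_lt hp) le_rfl
    have hU : Measurable[past (x 1) ζ {p | p.1 < k + 1}]
        fun ω => (⟨(⟨x (k + 1) ω, hrun.mem (by omega) (by omega) ω⟩,
          ⟨x k ω, hrun.mem hk (by omega) ω⟩),
          (hrun.isBallProj hF.convex hψ.le hk (by omega) ω).l1Norm_le⟩ :
          {u : X × X // l1Norm ((u.1 : Vec d) - (u.2 : Vec d)) ≤ ψ}) :=
      (hx.1.subtype_mk.prodMk hxk'.subtype_mk).subtype_mk
    have hS : Measurable[past (x 1) ζ {p | p.1 < k + 1}]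
        fun ω => G k ω - gradient (objective F P) (x k ω) :=
      (hxk.2 (by omega)).sub ((measurable_gradient _).comp hxk')
    -- The new error is the old one plus m centered increments with second moment at most 4L²ψ²/m²
    -- each.
    have h := hrun.lintegral_batch_le (by positivity)
      (isIncrement_smul_centered_sub hF hLip (1 / (m : ℝ))) hS hU hn m
    have e : ∀ ω, G (k + 1) ω - gradient (objective F P) (x (k + 1) ω) =
        G k ω - gradient (objective F P) (x k ω) + ∑ i ∈ Finset.range m,
        (1 / (m : ℝ)) • (stochGrad F (x (k + 1) ω) (ζ (k + 1) i ω) -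
          stochGrad F (x k ω) (ζ (k + 1) i ω) -
          (gradient (objective F P) (x (k + 1) ω) - gradient (objective F P) (x k ω))) :=
      fun ω => by
      rw [hrun.estimate_inner (k + 1) (by omega) hkK hs ω, batchSize, if_neg hs,
        ← Finset.smul_sum, Finset.sum_sub_distrib, Finset.sum_sub_distrib, Finset.sum_const,
        Finset.card_range, smul_sub _ _ (m • _), ← Nat.cast_smul_eq_nsmul ℝ m, smul_smul,
        one_div_mul_cancel hm0, one_smul, Nat.add_sub_cancel]
      abel
    simp only [e]
    refine h.trans ((add_le_add_left ih _).trans ?_)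
    rw [← ENNReal.ofReal_add (by positivity) (by positivity)]
    refine ENNReal.ofReal_le_ofReal (le_of_eq ?_)
    have hmod : (k + 1 - 1) % q = (k - 1) % q + 1 := by
      obtain ⟨a, rfl⟩ : ∃ a, k = a + 1 := ⟨k - 1, by omega⟩
      exact add_one_mod_of_ne_zero hq hs0
    rw [hmod]
    push_cast
    field_simp
    ring

end Run

/-- The choice n = ⌈log d⌉ gives d^(1/(n+1)) ≤ e and 2n + 1 ≤ 2 log d + 3. As log d ≥ log 2 > 0.69,
the latter is at most e³(log d)², and the product at most e⁴(log d)² = Ω². -/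
theorem exists_smoothConst_le {d : ℕ} (hd : 2 ≤ d) :
    ∃ n : ℕ, 1 ≤ n ∧ smoothConst d n ≤ constOmega d ^ 2 := by
  have hd0 : (0 : ℝ) < d := by positivity
  have hl : (0.69 : ℝ) ≤ Real.log d := by
    have h1 : Real.log 2 ≤ Real.log d := Real.log_le_log (by norm_num) (by exact_mod_cast hd)
    have := Real.log_two_gt_d9
    linarith
  set l := Real.log d with hl'
  refine ⟨⌈l⌉₊, Nat.one_le_ceil_iff.2 (by linarith), ?_⟩
  have hn1 : l ≤ ⌈l⌉₊ := Nat.le_ceil _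
  have hn2 : (⌈l⌉₊ : ℝ) < l + 1 := Nat.ceil_lt_add_one (by linarith)
  have he : (2.7 : ℝ) ≤ Real.exp 1 := by linarith [Real.exp_one_gt_d9]
  have h1 : (d : ℝ) ^ (1 / ((⌈l⌉₊ : ℝ) + 1)) ≤ Real.exp 1 := by
    rw [Real.rpow_def_of_pos hd0]
    refine Real.exp_le_exp.2 ?_
    rw [mul_one_div, div_le_one (by positivity)]
    linarith
  set e := Real.exp 1 with he'
  have h2 : 2 * l + 3 ≤ e ^ 3 * l ^ 2 := by
    have h3 : (2.7 : ℝ) ^ 3 ≤ e ^ 3 := by gcongr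
    have h4 : (2.7 : ℝ) ^ 3 * l ^ 2 ≤ e ^ 3 * l ^ 2 := by gcongr
    nlinarith
  calc smoothConst d ⌈l⌉₊ ≤ (2 * l + 3) * e := by
        unfold smoothConst
        exact mul_le_mul (by linarith) h1 (by positivity) (by linarith)
    _ ≤ e ^ 3 * l ^ 2 * e := by gcongr
    _ = constOmega d ^ 2 := by rw [constOmega, ← he', ← hl']; ring

/-! ### The random output index -/

section RandomIndex

variable {Ω : Type*} [MeasurableSpace Ω] {μ : Measure Ω} [IsProbabilityMeasure μ]

theorem ae_mem_Icc_of_uniform {K : ℕ} (hK : 1 ≤ K) {Y : Ω → ℕ} (hY : Measurable Y)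
    (hu : ∀ k, 1 ≤ k → k ≤ K → μ {ω | Y ω = k} = (K : ℝ≥0∞)⁻¹) :
    ∀ᵐ ω ∂μ, Y ω ∈ Finset.Icc 1 K := by
  have hm : ∀ k, MeasurableSet {ω | Y ω = k} := fun k => hY (measurableSet_singleton k)
  have h1 : μ (⋃ k ∈ Finset.Icc 1 K, {ω | Y ω = k}) = 1 := by
    rw [measure_biUnion_finset (fun i _ j _ hij => Set.disjoint_left.2 fun ω h1 h2 =>
      hij (h1.symm.trans h2)) fun k _ => hm k, Finset.sum_congr rfl fun k hk =>
      hu k (Finset.mem_Icc.1 hk).1 (Finset.mem_Icc.1 hk).2]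
    simp only [Finset.sum_const, Nat.card_Icc, Nat.add_sub_cancel, nsmul_eq_mul]
    exact ENNReal.mul_inv_cancel (by simpa using (by omega : K ≠ 0)) (ENNReal.natCast_ne_top K)
  have hU : MeasurableSet (⋃ k ∈ Finset.Icc 1 K, {ω | Y ω = k}) :=
    Finset.measurableSet_biUnion _ fun k _ => hm k
  have h2 := (mem_ae_iff_prob_eq_one (μ := μ) hU).2 h1
  filter_upwards [h2] with ω hω
  simpa using hω

/-- The expectation of a process at an independent, uniformly distributed index is at most the
average of the expectations of any measurable majorant. -/
theorem lintegral_uniform_index_le {K : ℕ} (hK : 1 ≤ K) {Y : Ω → ℕ} (hY : Measurable Y)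
    (hu : ∀ k, 1 ≤ k → k ≤ K → μ {ω | Y ω = k} = (K : ℝ≥0∞)⁻¹)
    {r R : ℕ → Ω → ℝ≥0∞} (hR : ∀ k ∈ Finset.Icc 1 K, Measurable (R k))
    (hind : ∀ k ∈ Finset.Icc 1 K, IndepFun Y (R k) μ)
    (hrR : ∀ k ∈ Finset.Icc 1 K, ∀ ω, r k ω ≤ R k ω) :
    ∫⁻ ω, r (Y ω) ω ∂μ ≤ (K : ℝ≥0∞)⁻¹ * ∑ k ∈ Finset.Icc 1 K, ∫⁻ ω, R k ω ∂μ := by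
  set I : ℕ → ℕ → ℝ≥0∞ := fun k => Set.indicator {k} 1 with hI
  have hIm : ∀ k, Measurable (I k) := fun k => measurable_of_countable _
  -- Almost surely exactly one indicator is 1. Measurability is needed of the majorant R only, not
  -- of r, which will be the residual.
  calc ∫⁻ ω, r (Y ω) ω ∂μ ≤ ∫⁻ ω, ∑ k ∈ Finset.Icc 1 K, (I k ∘ Y) ω * R k ω ∂μ := by
        refine lintegral_mono_ae ?_
        filter_upwards [ae_mem_Icc_of_uniform hK hY hu] with ω hω
        refine (hrR _ hω ω).trans ?_
        refine le_trans (le_of_eq ?_) (Finset.single_le_sum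
          (f := fun k => (I k ∘ Y) ω * R k ω) (fun _ _ => zero_le) hω)
        simp [hI]
    _ = ∑ k ∈ Finset.Icc 1 K, ∫⁻ ω, (I k ∘ Y) ω * R k ω ∂μ :=
        lintegral_finsetSum _ fun k hk => ((hIm k).comp hY).mul (hR k hk)
    _ = ∑ k ∈ Finset.Icc 1 K, (K : ℝ≥0∞)⁻¹ * ∫⁻ ω, R k ω ∂μ := by
        refine Finset.sum_congr rfl fun k hk => ?_
        have h1 := lintegral_mul_eq_lintegral_mul_lintegral_of_indepFun ((hIm k).comp hY)
          (hR k hk) ((hind k hk).comp (hIm k) measurable_id)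
        have h2 : ∫⁻ ω, (I k ∘ Y) ω ∂μ = (K : ℝ≥0∞)⁻¹ := by
          have hk' : MeasurableSet {ω | Y ω = k} := hY (measurableSet_singleton k)
          rw [← hu k (Finset.mem_Icc.1 hk).1 (Finset.mem_Icc.1 hk).2,
            ← lintegral_indicator_one hk']
          rfl
        rw [← h2]
        exact h1
    _ = _ := (Finset.mul_sum _ _ _).symm

end RandomIndex

/-! ### Expected residual bound of one iteration -/

section Run

variable {d : ℕ} {Ξ Ω : Type*} [MeasurableSpace Ξ] [MeasurableSpace Ω] {P : Measure Ξ}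
  {μ : Measure Ω} {X : Set (Vec d)} {F : Vec d → Ξ → ℝ} {ψ η : ℝ} {K q m m₁ : ℕ}
  {x G : ℕ → Ω → Vec d} {ζ : ℕ → ℕ → Ω → Ξ} {Y : Ω → ℕ}

/-- The estimation error `‖G^k - ∇f(x^k)‖_∞`. -/
def estimateError (F : Vec d → Ξ → ℝ) (P : Measure Ξ) (x G : ℕ → Ω → Vec d) (k : ℕ) (ω : Ω) : ℝ :=
  linfNorm (G k ω - gradient (objective F P) (x k ω))

theorem IsSpiderRun.measurable_past_estimateError (hF : IsProblem X F P) (hψ : 0 < ψ)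
    (hrun : IsSpiderRun X F P (indicatorFn (l1Ball d ψ)) η K q m m₁ μ x G ζ Y) {k : ℕ}
    (hk : 1 ≤ k) (hkK : k ≤ K) :
    Measurable[past (x 1) ζ Set.univ] (estimateError F P x G k) := by
  have h := hrun.measurable_past hF hψ hk (by omega)
  exact continuous_linfNorm.measurable.comp
    (((h.2 hkK).mono (past_mono (Set.subset_univ _)) le_rfl).sub
      ((measurable_gradient _).comp (h.1.mono (past_mono (Set.subset_univ _)) le_rfl)))

theorem IsSpiderRun.measurable_past_objective (hF : IsProblem X F P) (hψ : 0 < ψ)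
    (hrun : IsSpiderRun X F P (indicatorFn (l1Ball d ψ)) η K q m m₁ μ x G ζ Y) {k : ℕ}
    (hk : 1 ≤ k) (hkK : k ≤ K + 1) :
    Measurable[past (x 1) ζ Set.univ] fun ω => objective F P (x k ω) :=
  hF.differentiable_objective.continuous.measurable.comp
    ((hrun.measurable_past hF hψ hk hkK).1.mono (past_mono (Set.subset_univ _)) le_rfl)

theorem IsSpiderRun.indepFun_output {φ : Vec d → EReal}
    (hrun : IsSpiderRun X F P φ η K q m m₁ μ x G ζ Y) {𝒲 : Type*} [MeasurableSpace 𝒲] {W : Ω → 𝒲}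
    (hW : Measurable[past (x 1) ζ Set.univ] W) : IndepFun Y W μ := by
  have h := hrun.indep_output
  rw [IndepFun_iff_Indep] at h ⊢
  refine indep_of_indep_of_le_right h (hW.comap_le.trans ?_)
  refine past_le_of_measurable ?_ fun p hp => ?_
  · exact measurable_fst.comp (comap_measurable _)
  · have hm : Measurable fun w : Vec d × (ℕ × ℕ → Ξ) => w.2 p := by fun_prop
    exact hm.comp (comap_measurable _)

theorem IsSpiderRun.integral_sq_estimateError_le [IsProbabilityMeasure P] [IsProbabilityMeasure μ]
    (hd : 2 ≤ d) (hF : IsProblem X F P) (hψ : 0 < ψ) {σ L : ℝ} (hσ : BoundedVariance X F P σ)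
    (hLip : MeanSquaredSmooth X F P L) (hq : 1 ≤ q) (hm : 1 ≤ m) (hm₁ : 1 ≤ m₁)
    (hrun : IsSpiderRun X F P (indicatorFn (l1Ball d ψ)) η K q m m₁ μ x G ζ Y)
    {k : ℕ} (hk : 1 ≤ k) (hkK : k ≤ K) :
    Integrable (fun ω => estimateError F P x G k ω ^ 2) μ ∧
      ∫ ω, estimateError F P x G k ω ^ 2 ∂μ ≤
        constOmega d ^ 2 * σ ^ 2 / m₁ + 4 * constOmega d ^ 2 * L ^ 2 * q / m * ψ ^ 2 := by
  obtain ⟨n, hn, hC⟩ := exists_smoothConst_le hd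
  have h := hrun.lintegral_lpNormSq_error_le hF hψ hσ hLip hq hm hm₁ hn hk hkK
  have hle : ∫⁻ ω, ENNReal.ofReal (estimateError F P x G k ω ^ 2) ∂μ ≤
      ENNReal.ofReal (constOmega d ^ 2 * σ ^ 2 / m₁ +
        4 * constOmega d ^ 2 * L ^ 2 * q / m * ψ ^ 2) := by
    refine (lintegral_mono fun ω => ENNReal.ofReal_le_ofReal
      (sq_linfNorm_le_lpNormSq n _)).trans (h.trans (ENNReal.ofReal_le_ofReal ?_))
    have hmod : (((k - 1) % q : ℕ) : ℝ) ≤ q := by exact_mod_cast (Nat.mod_lt _ hq).le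
    calc smoothConst d n * (σ ^ 2 / m₁ + ((k - 1) % q : ℕ) * (4 * (L ^ 2 * ψ ^ 2) / m))
        ≤ constOmega d ^ 2 * (σ ^ 2 / m₁ + q * (4 * (L ^ 2 * ψ ^ 2) / m)) := by gcongr
      _ = _ := by ring
  have hmeas : Measurable fun ω => estimateError F P x G k ω ^ 2 :=
    ((hrun.measurable_past_estimateError hF hψ hk hkK).mono (hrun.past_le _) le_rfl).pow_const 2
  have hnn : 0 ≤ᵐ[μ] fun ω => estimateError F P x G k ω ^ 2 :=
    Eventually.of_forall fun ω => sq_nonneg _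
  have hint : Integrable (fun ω => estimateError F P x G k ω ^ 2) μ := by
    refine ⟨hmeas.aestronglyMeasurable, ?_⟩
    rw [hasFiniteIntegral_iff_ofReal hnn]
    exact hle.trans_lt ENNReal.ofReal_lt_top
  refine ⟨hint, ?_⟩
  rw [← ofReal_integral_eq_lintegral_ofReal hint hnn] at hle
  exact (ENNReal.ofReal_le_ofReal_iff (by positivity)).1 hle

theorem IsSpiderRun.integrable_estimateError [IsProbabilityMeasure μ] (hF : IsProblem X F P)
    (hψ : 0 < ψ) (hrun : IsSpiderRun X F P (indicatorFn (l1Ball d ψ)) η K q m m₁ μ x G ζ Y)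
    {k : ℕ} (hk : 1 ≤ k) (hkK : k ≤ K)
    (h2 : Integrable (fun ω => estimateError F P x G k ω ^ 2) μ) :
    Integrable (estimateError F P x G k) μ := by
  have hmeas := (hrun.measurable_past_estimateError hF hψ hk hkK).mono (hrun.past_le _) le_rfl
  exact ((memLp_two_iff_integrable_sq hmeas.aestronglyMeasurable).2 h2).integrable one_le_two

/-- The part of the residual bound at iteration `k` that telescopes, up to the estimation
error. -/
def stepBound (F : Vec d → Ξ → ℝ) (P : Measure Ξ) (x G : ℕ → Ω → Vec d) (L ψ t : ℝ) (k : ℕ)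
    (ω : Ω) : ℝ :=
  objective F P (x k ω) - objective F P (x (k + 1) ω) + t / 2 * estimateError F P x G k ω ^ 2 +
    (L / 2 + 1 / (2 * t)) * ψ ^ 2

theorem IsSpiderRun.residual_le [IsProbabilityMeasure P] (hF : IsProblem X F P) {L t : ℝ}
    (hL : 0 ≤ L) (hLip : MeanSquaredSmooth X F P L) (hψ : 0 < ψ) (hη : 0 < η) (ht : 0 < t)
    (hrun : IsSpiderRun X F P (indicatorFn (l1Ball d ψ)) η K q m m₁ μ x G ζ Y)
    {k : ℕ} (hk : 1 ≤ k) (hkK : k ≤ K) (ω : Ω) :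
    0 ≤ stepBound F P x G L ψ t k ω ∧ residual (objective F P) X (x (k + 1) ω) ≤
      ENNReal.ofReal (estimateError F P x G k ω + (L + 1 / η) * ψ +
        1 / ψ * stepBound F P x G L ψ t k ω) := by
  obtain ⟨ρ, hρ, hres, hbd⟩ := (hrun.isBallProj hF.convex hψ.le hk hkK ω).key_inequality hF.convex
    hF.differentiable_objective (fun _ hx _ hy => linfNorm_gradient_sub_le hF hL hLip hx hy)
    hL hψ hη ht (hrun.mem hk (by omega) ω)
  refine ⟨(mul_nonneg hψ.le hρ).trans hbd, hres.trans (ENNReal.ofReal_le_ofReal ?_)⟩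
  have h1 : ρ ≤ 1 / ψ * stepBound F P x G L ψ t k ω := by
    rw [one_div, le_inv_mul_iff₀ hψ]
    exact hbd
  unfold estimateError
  linarith

/-- Nonnegativity of `stepBound`, used at t = 1, bounds the next function value above by integrable
terms; `fLow` bounds it below. -/
theorem IsSpiderRun.integrable_objective [IsProbabilityMeasure P] [IsProbabilityMeasure μ]
    (hF : IsProblem X F P) {L fLow : ℝ}
    (hL : 0 ≤ L) (hLip : MeanSquaredSmooth X F P L) (hψ : 0 < ψ) (hη : 0 < η)
    (hLow : ∀ x ∈ X, fLow ≤ objective F P x)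
    (hrun : IsSpiderRun X F P (indicatorFn (l1Ball d ψ)) η K q m m₁ μ x G ζ Y)
    (hinit : Integrable (fun ω => objective F P (x 1 ω)) μ)
    (h2 : ∀ k, 1 ≤ k → k ≤ K → Integrable (fun ω => estimateError F P x G k ω ^ 2) μ)
    {k : ℕ} (hk : 1 ≤ k) : k ≤ K + 1 → Integrable (fun ω => objective F P (x k ω)) μ := by
  induction k, hk using Nat.le_induction with
  | base => exact fun _ => hinit
  | succ k hk ih =>
    intro hkK
    have hmeas := (hrun.measurable_past_objective hF hψ (k := k + 1) (by omega) hkK).mono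
      (hrun.past_le _) le_rfl
    have hi : Integrable (fun ω => objective F P (x k ω) +
        1 / 2 * estimateError F P x G k ω ^ 2 + (L / 2 + 1 / (2 * 1)) * ψ ^ 2) μ :=
      ((ih (by omega)).add ((h2 k hk (by omega)).const_mul _)).add (integrable_const _)
    refine (hi.abs.add (integrable_const |fLow|)).mono' hmeas.aestronglyMeasurable
      (Eventually.of_forall fun ω => ?_)
    have h1 := (hrun.residual_le hF hL hLip hψ hη one_pos hk (by omega) ω).1
    have h3 := hLow _ (hrun.mem (k := k + 1) (by omega) hkK ω)
    unfold stepBound at h1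
    simp only [Pi.add_apply, Real.norm_eq_abs]
    refine abs_le.2 ⟨?_, ?_⟩
    · have := neg_abs_le fLow
      have := abs_nonneg (objective F P (x k ω) + 1 / 2 * estimateError F P x G k ω ^ 2 +
        (L / 2 + 1 / (2 * 1)) * ψ ^ 2)
      linarith
    · have := le_abs_self (objective F P (x k ω) + 1 / 2 * estimateError F P x G k ω ^ 2 +
        (L / 2 + 1 / (2 * 1)) * ψ ^ 2)
      have := abs_nonneg fLow
      linarith

theorem IsSpiderRun.integral_step_le [IsProbabilityMeasure P] [IsProbabilityMeasure μ]
    (hF : IsProblem X F P) {L t V : ℝ} (hψ : 0 < ψ) (ht : 0 < t)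
    (hrun : IsSpiderRun X F P (indicatorFn (l1Ball d ψ)) η K q m m₁ μ x G ζ Y)
    {k : ℕ} (hk : 1 ≤ k) (hkK : k ≤ K)
    (hf : Integrable (fun ω => objective F P (x k ω)) μ)
    (hf' : Integrable (fun ω => objective F P (x (k + 1) ω)) μ)
    (h2 : Integrable (fun ω => estimateError F P x G k ω ^ 2) μ)
    (hV : ∫ ω, estimateError F P x G k ω ^ 2 ∂μ ≤ V) :
    Integrable (fun ω => estimateError F P x G k ω + (L + 1 / η) * ψ +
        1 / ψ * stepBound F P x G L ψ t k ω) μ ∧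
      ∫ ω, (estimateError F P x G k ω + (L + 1 / η) * ψ +
        1 / ψ * stepBound F P x G L ψ t k ω) ∂μ ≤
      Real.sqrt V + (L + 1 / η) * ψ + 1 / ψ * ((∫ ω, objective F P (x k ω) ∂μ) -
        (∫ ω, objective F P (x (k + 1) ω) ∂μ) + t / 2 * V + (L / 2 + 1 / (2 * t)) * ψ ^ 2) := by
  have h1 := hrun.integrable_estimateError hF hψ hk hkK h2
  have hsqrt : ∫ ω, estimateError F P x G k ω ∂μ ≤ Real.sqrt V :=
    Real.le_sqrt_of_sq_le ((sq_integral_le h1 h2).trans hV)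
  have i1 : Integrable (fun ω => estimateError F P x G k ω + (L + 1 / η) * ψ) μ :=
    h1.add (integrable_const _)
  have i2 : Integrable
      (fun ω => objective F P (x k ω) - objective F P (x (k + 1) ω)) μ := hf.sub hf'
  have i3 : Integrable (fun ω => objective F P (x k ω) - objective F P (x (k + 1) ω) +
      t / 2 * estimateError F P x G k ω ^ 2) μ := i2.add (h2.const_mul _)
  have i4 : Integrable (stepBound F P x G L ψ t k) μ := i3.add (integrable_const _)
  refine ⟨i1.add (i4.const_mul _), ?_⟩
  rw [integral_add i1 (i4.const_mul _), integral_add h1 (integrable_const _),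
    integral_const_mul (1 / ψ)]
  unfold stepBound
  rw [integral_add i3 (integrable_const _), integral_add i2 (h2.const_mul _), integral_sub hf hf',
    integral_const_mul (t / 2)]
  simp only [integral_const, probReal_univ, one_smul]
  gcongr

end Run

end SpiderProx

end

/-! ### The convergence bound -/

theorem theorem4 {d : ℕ} (hd : 2 ≤ d)
    {Ξ : Type*} [MeasurableSpace Ξ] (P : Measure Ξ) [IsProbabilityMeasure P]
    {Ω : Type*} [MeasurableSpace Ω] (μ : Measure Ω) [IsProbabilityMeasure μ]
    (X : Set (SpiderProx.Vec d)) (F : SpiderProx.Vec d → Ξ → ℝ)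
    (hF : SpiderProx.IsProblem X F P)
    (σ : ℝ) (hσ : SpiderProx.BoundedVariance X F P σ)
    (L : ℝ) (hL : 0 ≤ L) (hLip : SpiderProx.MeanSquaredSmooth X F P L)
    (fLow : ℝ) (hLow : ∀ x ∈ X, fLow ≤ SpiderProx.objective F P x)
    (ψ η : ℝ) (hψ : 0 < ψ) (hη : 0 < η)
    (K q m m₁ : ℕ) (hK : 1 ≤ K) (hq : 1 ≤ q) (hm : 1 ≤ m) (hm₁ : 1 ≤ m₁)
    (x G : ℕ → Ω → SpiderProx.Vec d) (ζ : ℕ → ℕ → Ω → Ξ) (Y : Ω → ℕ)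
    (hrun : SpiderProx.IsSpiderRun X F P (SpiderProx.indicatorFn (SpiderProx.l1Ball d ψ)) η
      K q m m₁ μ x G ζ Y)
    (hinit : Integrable (fun ω => SpiderProx.objective F P (x 1 ω)) μ)
    (Δf : ℝ) (hΔf : Δf = (∫ ω, SpiderProx.objective F P (x 1 ω) ∂μ) - fLow)
    (t : ℝ) (ht : 0 < t) :
    ∫⁻ ω, SpiderProx.residual (SpiderProx.objective F P) X (x (Y ω + 1) ω) ∂μ ≤
      ENNReal.ofReal
        ((L + 1 / η + Real.sqrt (4 * SpiderProx.constOmega d ^ 2 * L ^ 2 * q / m)) * ψ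
          + Real.sqrt (SpiderProx.constOmega d * SpiderProx.constC * Real.log d * σ ^ 2 / m₁)
          + 1 / ψ * (Δf / K
            + t * SpiderProx.constOmega d * SpiderProx.constC * Real.log d * σ ^ 2 / (2 * m₁)
            + (2 * t * SpiderProx.constOmega d ^ 2 * L ^ 2 * q / m + L / 2 + 1 / (2 * t))
              * ψ ^ 2)) := by
  set f := SpiderProx.objective F P with hf
  set Ωd := SpiderProx.constOmega d with hΩd
  set V : ℝ := Ωd ^ 2 * σ ^ 2 / m₁ + 4 * Ωd ^ 2 * L ^ 2 * q / m * ψ ^ 2 with hV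
  have herr : ∀ k, 1 ≤ k → k ≤ K →
      Integrable (fun ω => SpiderProx.estimateError F P x G k ω ^ 2) μ ∧
        ∫ ω, SpiderProx.estimateError F P x G k ω ^ 2 ∂μ ≤ V := fun k hk hkK =>
    hrun.integral_sq_estimateError_le hd hF hψ hσ hLip hq hm hm₁ hk hkK
  have hfi : ∀ k, 1 ≤ k → k ≤ K + 1 → Integrable (fun ω => f (x k ω)) μ := fun k hk hkK =>
    hrun.integrable_objective hF hL hLip hψ hη hLow hinit (fun k h1 h2 => (herr k h1 h2).1) hk hkK
  set a : ℕ → ℝ := fun k => ∫ ω, f (x k ω) ∂μ with ha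
  set R : ℕ → Ω → ℝ := fun k ω => SpiderProx.estimateError F P x G k ω + (L + 1 / η) * ψ +
    1 / ψ * SpiderProx.stepBound F P x G L ψ t k ω with hR
  have hRi : ∀ k ∈ Finset.Icc 1 K, Integrable (R k) μ ∧ ∫ ω, R k ω ∂μ ≤
      Real.sqrt V + (L + 1 / η) * ψ + 1 / ψ * (a k - a (k + 1) + t / 2 * V +
        (L / 2 + 1 / (2 * t)) * ψ ^ 2) := fun k hk => by
    obtain ⟨hk1, hkK⟩ := Finset.mem_Icc.1 hk
    exact hrun.integral_step_le hF hψ ht hk1 hkK (hfi k hk1 (by omega))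
      (hfi (k + 1) (by omega) (by omega)) (herr k hk1 hkK).1 (herr k hk1 hkK).2
  have hR0 : ∀ k ∈ Finset.Icc 1 K, ∀ ω, 0 ≤ R k ω := fun k hk ω => by
    obtain ⟨hk1, hkK⟩ := Finset.mem_Icc.1 hk
    have h1 := (hrun.residual_le hF hL hLip hψ hη ht hk1 hkK ω).1
    have h2 : 0 ≤ SpiderProx.estimateError F P x G k ω := SpiderProx.linfNorm_nonneg _
    simp only [hR]
    positivity
  have hRm : ∀ k ∈ Finset.Icc 1 K,
      Measurable[SpiderProx.past (x 1) ζ Set.univ] fun ω => ENNReal.ofReal (R k ω) :=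
    fun k hk => by
    obtain ⟨hk1, hkK⟩ := Finset.mem_Icc.1 hk
    have he := hrun.measurable_past_estimateError hF hψ hk1 hkK
    have h1 := hrun.measurable_past_objective hF hψ hk1 (by omega)
    have h2 := hrun.measurable_past_objective hF hψ (k := k + 1) (by omega) (by omega)
    exact ((he.add_const _).add (((((h1.sub h2).add ((he.pow_const 2).const_mul _)).add_const
      _)).const_mul _)).ennreal_ofReal
  -- Each R k is a function of the initial point and the samples, hence independent of Y.
  have hmain := SpiderProx.lintegral_uniform_index_le hK hrun.measurable_output
    hrun.output_uniform (r := fun k ω => SpiderProx.residual f X (x (k + 1) ω))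
    (R := fun k ω => ENNReal.ofReal (R k ω))
    (fun k hk => (hRm k hk).mono (hrun.past_le _) le_rfl)
    (fun k hk => hrun.indepFun_output (hRm k hk))
    (fun k hk ω => (hrun.residual_le hF hL hLip hψ hη ht (Finset.mem_Icc.1 hk).1
      (Finset.mem_Icc.1 hk).2 ω).2)
  have hK0 : (0 : ℝ) < K := by exact_mod_cast hK
  have hsum : (K : ℝ≥0∞)⁻¹ * ∑ k ∈ Finset.Icc 1 K, ∫⁻ ω, ENNReal.ofReal (R k ω) ∂μ =
      ENNReal.ofReal ((K : ℝ)⁻¹ * ∑ k ∈ Finset.Icc 1 K, ∫ ω, R k ω ∂μ) := by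
    rw [ENNReal.ofReal_mul (by positivity), ENNReal.ofReal_inv_of_pos hK0,
      ENNReal.ofReal_natCast, ENNReal.ofReal_sum_of_nonneg fun k hk =>
        integral_nonneg (hR0 k hk)]
    congr 1
    exact Finset.sum_congr rfl fun k hk => (ofReal_integral_eq_lintegral_ofReal (hRi k hk).1
      (Eventually.of_forall (hR0 k hk))).symm
  refine hmain.trans (hsum.le.trans (ENNReal.ofReal_le_ofReal ?_))
  have htel : ∑ k ∈ Finset.Icc 1 K, (a k - a (k + 1)) = a 1 - a (K + 1) := by
    rw [← Finset.Ico_add_one_right_eq_Icc, Finset.sum_Ico_eq_sum_range]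
    simp only [Nat.add_sub_cancel]
    have := Finset.sum_range_sub' (fun k => a (1 + k)) K
    simpa [add_comm, add_left_comm, add_assoc] using this
  have hlast : fLow ≤ a (K + 1) := by
    have h1 := integral_mono (integrable_const fLow) (hfi (K + 1) (by omega) le_rfl)
      fun ω => hLow _ (hrun.mem (by omega) le_rfl ω)
    simpa using h1
  have hconst : Ωd * SpiderProx.constC * Real.log d = Ωd ^ 2 := by
    rw [hΩd, SpiderProx.constOmega, SpiderProx.constC]; ring
  -- Subadditivity of the square root separates the two variance contributions.
  have hsqrt : Real.sqrt V ≤ Real.sqrt (4 * Ωd ^ 2 * L ^ 2 * q / m) * ψ +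
      Real.sqrt (Ωd ^ 2 * σ ^ 2 / m₁) := by
    refine Real.sqrt_le_iff.2 ⟨by positivity, ?_⟩
    have h1 := Real.sq_sqrt (show 0 ≤ 4 * Ωd ^ 2 * L ^ 2 * q / m by positivity)
    have h2 := Real.sq_sqrt (show 0 ≤ Ωd ^ 2 * σ ^ 2 / m₁ by positivity)
    rw [add_sq, mul_pow, h1, h2]
    have : 0 ≤ 2 * (Real.sqrt (4 * Ωd ^ 2 * L ^ 2 * q / m) * ψ) *
      Real.sqrt (Ωd ^ 2 * σ ^ 2 / m₁) := by positivity
    linarith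
  have hbound : (K : ℝ)⁻¹ * ∑ k ∈ Finset.Icc 1 K, ∫ ω, R k ω ∂μ ≤
      Real.sqrt V + (L + 1 / η) * ψ + 1 / ψ * (Δf / K + t / 2 * V +
        (L / 2 + 1 / (2 * t)) * ψ ^ 2) := by
    have h1 := Finset.sum_le_sum fun k hk => (hRi k hk).2
    simp only [Finset.sum_add_distrib, ← Finset.mul_sum, htel, Finset.sum_const, Nat.card_Icc,
      Nat.add_sub_cancel, nsmul_eq_mul] at h1
    have h2 : a 1 - a (K + 1) ≤ Δf := by rw [hΔf]; linarith
    rw [inv_mul_le_iff₀ hK0]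
    refine h1.trans ?_
    have h3 : 1 / ψ * (a 1 - a (K + 1)) ≤ 1 / ψ * Δf := by gcongr
    have h4 : K * (1 / ψ * (Δf / K)) = 1 / ψ * Δf := by field_simp
    linarith
  refine hbound.trans ?_
  rw [hconst]
  have h5 : 1 / ψ * (Δf / K + t / 2 * V + (L / 2 + 1 / (2 * t)) * ψ ^ 2) =
      1 / ψ * (Δf / K + t * Ωd ^ 2 * σ ^ 2 / (2 * m₁) +
        (2 * t * Ωd ^ 2 * L ^ 2 * q / m + L / 2 + 1 / (2 * t)) * ψ ^ 2) := by
    rw [hV]; congr 1; field_simp; ring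
  have h6 : t * Ωd * SpiderProx.constC * Real.log d * σ ^ 2 = t * Ωd ^ 2 * σ ^ 2 := by
    rw [← hconst]; ring
  rw [h5, h6]
  linarith
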